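/- \textbf{Theorem.} Let $\mathcal{C}$ be a permutation class, i.e.\ a set of finite permutations that is closed under taking contained patterns. Suppose that $\mathcal{C}$ is \emph{monotone-griddable}: there are $k,\ell$ and a $k\times\ell$ matrix $\mathcal{M}$ (with $k$ columns and $\ell$ rows), each of whose entries is $\mathrm{Av}(21)$ (increasing permutations), $\mathrm{Av}(12)$ (decreasing permutations) or $\emptyset$, such that for every $\sigma\in\mathcal{C}$, with $n$ the length of $\sigma$, there are sequences $1=c_1\le\dots\le c_{k+1}=n+1$ and $1=r_1\le\dots\le r_{\ell+1}=n+1$ for which, for all $i\in[k]$ and $j\in[\ell]$, the set of points $(x,\sigma_x)$ with $c_i\le x<c_{i+1}$ and $r_j\le \sigma_x<r_{j+1}$ is either empty or order-isomorphic to a permutation in $\mathcal{M}_{i,j}$. Then $\mathcal{C}$-PPM is solvable in polynomial time: there are an algorithm (a program of a unit-cost random access machine with addition and subtraction) and a polynomial $T$, both depending only on $\mathcal{C}$, such that for all $\pi,\tau\in\mathcal{C}$, of lengths $m$ and $n$, the algorithm, given $\pi$ and $\tau$, decides correctly within $T(m+n)$ steps whether $\tau$ contains $\pi$. (This is a promise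 problem: the behaviour on inputs with $\pi\notin\mathcal{C}$ or $\tau\notin\mathcal{C}$ is not restricted.) -/

import Mathlib

/-! ### Permutations, containment, classes -/

/-- A permutation of arbitrary finite length `len`. The position `i : Fin len` and the value
`perm i` stand for the point `(i + 1, perm i + 1)` of the permutation diagram. -/
structure FinPerm where
  len : ℕ
  perm : Equiv.Perm (Fin len)

namespace FinPerm

/-- `f` maps the positions of `π` to positions of `τ` so that, on diagrams, it is an
order-isomorphism from all of `π` onto the points of `τ` at the positions in the range of `f`:
both horizontal and vertical comparisons are preserved and reflected. -/
def IsEmbedding (π τ : FinPerm) (f : Fin π.len → Fin τ.len) : Prop :=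
  ∀ a b : Fin π.len,
    (f a < f b ↔ a < b) ∧ (τ.perm (f a) < τ.perm (f b) ↔ π.perm a < π.perm b)

/-- `τ.Contains π`: the text `τ` contains the pattern `π`. -/
def Contains (τ π : FinPerm) : Prop :=
  ∃ f : Fin π.len → Fin τ.len, IsEmbedding π τ f

theorem Contains.trans {ρ τ π : FinPerm} (h₁ : ρ.Contains τ) (h₂ : τ.Contains π) :
    ρ.Contains π := by
  obtain ⟨f, hf⟩ := h₁
  obtain ⟨g, hg⟩ := h₂
  exact ⟨f ∘ g, fun a b =>
    ⟨(hf (g a) (g b)).1.trans (hg a b).1, (hf (g a) (g b)).2.trans (hg a b).2⟩⟩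

/-- `σ` is the reduction of the set of points of `π` whose positions form the set `S`. -/
def IsReduction (σ π : FinPerm) (S : Set (Fin π.len)) : Prop :=
  ∃ f : Fin σ.len → Fin π.len, IsEmbedding σ π f ∧ Set.range f = S

/-- The permutation `12`. -/
def p12 : FinPerm := ⟨2, Equiv.refl _⟩

/-- The permutation `21`. -/
def p21 : FinPerm := ⟨2, Equiv.swap 0 1⟩

end FinPerm

/-- A permutation class: a set of permutations closed under taking contained permutations. -/
structure PermClass where
  carrier : Set FinPerm
  down : ∀ τ ∈ carrier, ∀ π : FinPerm, τ.Contains π → π ∈ carrier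

namespace PermClass

/-- The class `Av(σ)` of all permutations that avoid `σ`. -/
def av (σ : FinPerm) : PermClass where
  carrier := {τ | ¬ τ.Contains σ}
  down := fun _ hτ _ hπ h => hτ (hπ.trans h)

/-- The class with no members. -/
def empty : PermClass where
  carrier := ∅
  down := fun _ hτ => hτ.elim

end PermClass

/-! ### Griddings -/

/-- A gridding matrix with `k` columns and `l` rows; the column index comes first and rows are
numbered from bottom to top. -/
abbrev GriddingMatrix (k l : ℕ) := Fin k → Fin l → PermClass

/-- Every entry is the class of increasing permutations, the class of decreasing permutations, or
the empty class. -/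
def GriddingMatrix.IsMonotone {k l : ℕ} (M : GriddingMatrix k l) : Prop :=
  ∀ i j, M i j = PermClass.av FinPerm.p21 ∨ M i j = PermClass.av FinPerm.p12 ∨
    M i j = PermClass.empty

/-- A `k × l`-gridding of `π`: two weakly increasing sequences of cut points. As positions and
values are counted from `0` here, the sequences run from `0` to `n` instead of from `1` to
`n + 1`. -/
structure Gridding (k l : ℕ) (π : FinPerm) where
  c : Fin (k + 1) → ℕ
  r : Fin (l + 1) → ℕ
  c_mono : Monotone c
  r_mono : Monotone r
  c_first : c 0 = 0
  c_last : c (Fin.last k) = π.len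
  r_first : r 0 = 0
  r_last : r (Fin.last l) = π.len

/-- The `(i, j)`-cell of a gridded permutation, as the set of positions of its points. -/
def Gridding.cell {k l : ℕ} {π : FinPerm} (g : Gridding k l π) (i : Fin k) (j : Fin l) :
    Set (Fin π.len) :=
  {p | (g.c i.castSucc ≤ (p : ℕ) ∧ (p : ℕ) < g.c i.succ) ∧
    (g.r j.castSucc ≤ (π.perm p : ℕ) ∧ (π.perm p : ℕ) < g.r j.succ)}

/-- `g` is an `M`-gridding: in every cell that has a point, the reduction of the cell belongs to
the corresponding entry of `M`. (Cells without points are allowed at every entry, so that the entry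
`∅` says that the cell has no points.) -/
def Gridding.IsGriddingFor {k l : ℕ} {π : FinPerm} (g : Gridding k l π)
    (M : GriddingMatrix k l) : Prop :=
  ∀ i j, (g.cell i j).Nonempty → ∃ σ ∈ (M i j).carrier, FinPerm.IsReduction σ π (g.cell i j)

/-- The grid class of `M`: the set of all `M`-griddable permutations. -/
def gridClass {k l : ℕ} (M : GriddingMatrix k l) : Set FinPerm :=
  {π | ∃ g : Gridding k l π, g.IsGriddingFor M}

/-- A class is monotone-griddable if it lies in the grid class of a monotone gridding matrix. -/
def PermClass.MonotoneGriddable (C : PermClass) : Prop :=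
  ∃ (k l : ℕ) (M : GriddingMatrix k l), M.IsMonotone ∧ C.carrier ⊆ gridClass M

/-! ### Random access machines -/

/-- Instructions of a random access machine with registers `R 0, R 1, R 2, …` that hold natural
numbers, and with a one-way read-only input sequence of natural numbers. There is no multiplication,
so that unit-cost time is polynomially equivalent to the time of Turing machines. -/
inductive RAMInstr where
  /-- `R i := v` -/
  | const (i v : ℕ)
  /-- `R i := R a + R b` -/
  | add (i a b : ℕ)
  /-- `R i := max (R a - R b) 0` -/
  | sub (i a b : ℕ)
  /-- `R i := R (R a)` -/
  | load (i a : ℕ)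
  /-- `R (R i) := R a` -/
  | store (i a : ℕ)
  /-- `R i :=` the next number of the input (`0` if the input is used up) -/
  | read (i : ℕ)
  /-- go to instruction number `t` -/
  | jump (t : ℕ)
  /-- go to instruction number `t` if `R i = 0`, and to the next instruction otherwise -/
  | jumpZero (i t : ℕ)

/-- A program: its instructions are numbered from `0`. -/
abbrev RAMProgram := List RAMInstr

/-- A configuration: number of the current instruction, registers, unread part of the input. -/
structure RAMConfig where
  pc : ℕ
  reg : ℕ → ℕ
  inp : List ℕ

/-- The effect of one instruction. -/
def RAMInstr.exec (s : RAMConfig) : RAMInstr → RAMConfig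
  | .const i v => ⟨s.pc + 1, Function.update s.reg i v, s.inp⟩
  | .add i a b => ⟨s.pc + 1, Function.update s.reg i (s.reg a + s.reg b), s.inp⟩
  | .sub i a b => ⟨s.pc + 1, Function.update s.reg i (s.reg a - s.reg b), s.inp⟩
  | .load i a => ⟨s.pc + 1, Function.update s.reg i (s.reg (s.reg a)), s.inp⟩
  | .store i a => ⟨s.pc + 1, Function.update s.reg (s.reg i) (s.reg a), s.inp⟩
  | .read i => ⟨s.pc + 1, Function.update s.reg i (s.inp.headD 0), s.inp.tail⟩
  | .jump t => ⟨t, s.reg, s.inp⟩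
  | .jumpZero i t => ⟨if s.reg i = 0 then t else s.pc + 1, s.reg, s.inp⟩

namespace RAMProgram

/-- The initial configuration on an input: all registers are `0`. -/
def init (input : List ℕ) : RAMConfig := ⟨0, fun _ => 0, input⟩

/-- The machine has halted when no instruction has the current number. -/
def Halted (P : RAMProgram) (s : RAMConfig) : Prop := P.length ≤ s.pc

/-- One step of the machine; a halted machine stays as it is. -/
def step (P : RAMProgram) (s : RAMConfig) : RAMConfig :=
  match P[s.pc]? with
  | some I => I.exec s
  | none => s

/-- On the given input, `P` halts after at most `t` steps, with the number `out` in register `0`. -/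
def OutputsWithin (P : RAMProgram) (input : List ℕ) (out t : ℕ) : Prop :=
  ∃ u ≤ t, P.Halted (P.step^[u] (init input)) ∧ (P.step^[u] (init input)).reg 0 = out

end RAMProgram

/-! ### The pattern matching problem of a class -/

/-- A permutation as its length `n` followed by its sequence of values, from `{1, …, n}`. -/
def FinPerm.code (π : FinPerm) : List ℕ :=
  π.len :: List.ofFn (fun i => (π.perm i : ℕ) + 1)

open Classical in
/-- `C`-PPM is solvable in polynomial time: one program decides, for every pattern `π` and text `τ`
that both belong to `C`, whether `τ` contains `π` (answer `1`) or avoids it (answer `0`), in a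
number of steps that is at most a polynomial in the total length of `π` and `τ`. This is a promise
problem: nothing is asked for other inputs. -/
def PermClass.PPMSolvableInPolyTime (C : PermClass) : Prop :=
  ∃ (P : RAMProgram) (T : Polynomial ℕ), ∀ π ∈ C.carrier, ∀ τ ∈ C.carrier,
    P.OutputsWithin (π.code ++ τ.code) (if τ.Contains π then 1 else 0)
      (T.eval (π.len + τ.len))

/-!
A pattern `π` embeds into a text `τ` that lies in the grid class of a monotone matrix `M` iff there
are cut points for `τ` and for `π` such that some embedding sends every point of `π` to a point of
`τ` in the cell of the same name. For a gridding of `τ` the cut points of `π` arise as pullbacks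
(`exists_cuts`). There are only polynomially many choices of cut points, as the size of `M` is
constant, and for each choice the problem is an instance of 2-SAT: for every coordinate of every
image point and every threshold `s` there is a variable saying that the coordinate is at least `s`.
Keeping the order of points is expressed by implications between such literals, and so is the fact
that both coordinates belong to a point of `τ`, because within a cell the value is a monotone
function of the position (`Implies`). Solutions of these implications are embeddings for every
choice of cut points, right or wrong (`Solves.exists_embeds`), so that it need not be checked that
the cut points form griddings.

By `exists_assignment`, 2-SAT comes down to reachability between literals, and reachability is
computed by iterating a closure step on an array of bits (`iterate_closure`).

The program itself is obtained from a small language `Ex` of expressions with bounded sums, which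
serve as quantifiers, and with iteration of an array of bits. Every expression has polynomially
bounded value (`Ex.eval_le_bd`) and is compiled, through the structured programs of `Cmd`, into
machine code that computes this value in polynomial time (`Ex.compSpec`). The decision procedure is
one such expression (`Ex.decision`), evaluated after the input has been copied to memory.
-/

/-! ### Structured programs for random access machines -/

/-- Instructions that change data only and pass control to the next instruction. -/
def RAMInstr.IsPlain : RAMInstr → Bool
  | .jump _ => false
  | .jumpZero _ _ => false
  | _ => true

/-- The effect of an instruction on the data, that is, on the registers and the unread input. -/
def RAMInstr.act (x : (ℕ → ℕ) × List ℕ) (I : RAMInstr) : (ℕ → ℕ) × List ℕ :=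
  ((I.exec ⟨0, x.1, x.2⟩).reg, (I.exec ⟨0, x.1, x.2⟩).inp)

/-- Structured programs: blocks of plain instructions, sequential composition, and loops that are
repeated as long as a given register is not `0`. -/
inductive Cmd where
  | ops (l : List RAMInstr)
  | seq (c d : Cmd)
  | loop (r : ℕ) (c : Cmd)

namespace Cmd

/-- The number of instructions of the compiled program. -/
def len : Cmd → ℕ
  | ops l => l.length
  | seq c d => c.len + d.len
  | loop _ c => c.len + 2

/-- The machine code of a structured program, to be placed at instruction number `o`. -/
def code : Cmd → ℕ → List RAMInstr
  | ops l, _ => l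
  | seq c d, o => c.code o ++ d.code (o + c.len)
  | loop r c, o => .jumpZero r (o + c.len + 2) :: (c.code (o + 1) ++ [.jump o])

theorem length_code (c : Cmd) : ∀ o, (c.code o).length = c.len := by
  induction c with
  | ops l => intro o; rfl
  | seq c d hc hd => intro o; simp [code, len, hc, hd]
  | loop r c hc => intro o; simp [code, len, hc]

/-- The instruction sequence `l` occurs in `P` from instruction number `o` on. -/
def CodeAt (P : RAMProgram) (o : ℕ) (l : List RAMInstr) : Prop :=
  ∃ a b, P = a ++ l ++ b ∧ a.length = o

theorem CodeAt.left {P : RAMProgram} {o : ℕ} {l l' : List RAMInstr}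
    (h : CodeAt P o (l ++ l')) : CodeAt P o l := by
  obtain ⟨a, b, rfl, ha⟩ := h
  exact ⟨a, l' ++ b, by simp, ha⟩

theorem CodeAt.right {P : RAMProgram} {o : ℕ} {l l' : List RAMInstr}
    (h : CodeAt P o (l ++ l')) : CodeAt P (o + l.length) l' := by
  obtain ⟨a, b, rfl, ha⟩ := h
  exact ⟨a ++ l, b, by simp, by simp [ha]⟩

theorem CodeAt.step {P : RAMProgram} {o : ℕ} {I : RAMInstr} {l : List RAMInstr}
    (h : CodeAt P o (I :: l)) (reg : ℕ → ℕ) (inp : List ℕ) :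
    P.step ⟨o, reg, inp⟩ = I.exec ⟨o, reg, inp⟩ := by
  obtain ⟨a, b, rfl, ha⟩ := h
  subst ha
  simp [RAMProgram.step]

/-- Wherever its code stands, `c` started with the data `x` passes control to the instruction
behind its code after at most `t` steps, with the data `y`. -/
def Runs (c : Cmd) (x : (ℕ → ℕ) × List ℕ) (t : ℕ) (y : (ℕ → ℕ) × List ℕ) : Prop :=
  ∀ P o, CodeAt P o (c.code o) →
    ∃ u ≤ t, P.step^[u] ⟨o, x.1, x.2⟩ = ⟨o + c.len, y.1, y.2⟩

theorem Runs.mono {c : Cmd} {x y : (ℕ → ℕ) × List ℕ} {t t' : ℕ} (h : c.Runs x t y)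
    (ht : t ≤ t') : c.Runs x t' y := fun P o hP => by
  obtain ⟨u, hu, e⟩ := h P o hP
  exact ⟨u, hu.trans ht, e⟩

theorem runs_ops {l : List RAMInstr} (hl : l.all RAMInstr.IsPlain = true)
    (x : (ℕ → ℕ) × List ℕ) : (ops l).Runs x l.length (l.foldl RAMInstr.act x) := by
  intro P o hP
  refine ⟨l.length, le_rfl, ?_⟩
  simp only [code, len] at hP ⊢
  induction l generalizing o x with
  | nil => rfl
  | cons I l ih =>
    rw [List.all_cons, Bool.and_eq_true] at hl
    have h1 : P.step ⟨o, x.1, x.2⟩ = ⟨o + 1, (I.act x).1, (I.act x).2⟩ := by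
      rw [hP.step]
      obtain ⟨hI, -⟩ := hl
      cases I <;> first | rfl | simp [RAMInstr.IsPlain] at hI
    have h2 : CodeAt P (o + 1) l := CodeAt.right (l := [I]) hP
    rw [List.length_cons, Function.iterate_succ_apply, h1, ih hl.2 (I.act x) (o + 1) h2,
      List.foldl_cons]
    congr 1
    omega

theorem Runs.seq {c d : Cmd} {x y z : (ℕ → ℕ) × List ℕ} {t t' : ℕ} (h : c.Runs x t y)
    (h' : d.Runs y t' z) : (c.seq d).Runs x (t + t') z := by
  intro P o hP
  obtain ⟨u, hu, e⟩ := h P o hP.left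
  obtain ⟨u', hu', e'⟩ := h' P (o + c.len) (by
    have := hP.right
    rwa [length_code] at this)
  refine ⟨u' + u, by omega, ?_⟩
  rw [Function.iterate_add_apply, e, e', len, add_assoc]

theorem runs_loop_zero {r : ℕ} (c : Cmd) {x : (ℕ → ℕ) × List ℕ} (hx : x.1 r = 0) :
    (loop r c).Runs x 1 x := by
  intro P o hP
  refine ⟨1, le_rfl, ?_⟩
  rw [code] at hP
  rw [Function.iterate_one, hP.step]
  simp [RAMInstr.exec, hx, len, add_assoc]

theorem runs_loop_step {r : ℕ} {c : Cmd} {x y z : (ℕ → ℕ) × List ℕ} {t t' : ℕ} (hx : x.1 r ≠ 0)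
    (h : c.Runs x t y) (h' : (loop r c).Runs y t' z) : (loop r c).Runs x (t + 2 + t') z := by
  intro P o hP
  obtain ⟨u', hu', e'⟩ := h' P o hP
  rw [code] at hP
  have h0 : P.step ⟨o, x.1, x.2⟩ = ⟨o + 1, x.1, x.2⟩ := by
    rw [hP.step]
    simp [RAMInstr.exec, hx]
  have h1 : CodeAt P (o + 1) (c.code (o + 1) ++ [.jump o]) :=
    CodeAt.right (l := [RAMInstr.jumpZero r (o + c.len + 2)]) hP
  obtain ⟨u, hu, e⟩ := h P (o + 1) h1.left
  have h2 := h1.right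
  rw [length_code] at h2
  have h3 : P.step ⟨o + 1 + c.len, y.1, y.2⟩ = ⟨o, y.1, y.2⟩ := by
    rw [h2.step]
    rfl
  refine ⟨u' + (1 + (u + 1)), by omega, ?_⟩
  rw [Function.iterate_add_apply, Function.iterate_add_apply, Function.iterate_add_apply,
    Function.iterate_one, h0, e, h3, e']

/-- Repeat `c` with the values `n - 1, …, 1, 0` in register `r`, where `n` is the value of `r` at
the start. Register `u` is used to hold the number `1`. -/
def countdown (r u : ℕ) (c : Cmd) : Cmd :=
  loop r (seq (ops [.const u 1, .sub r r u]) c)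

theorem runs_countdown {r u : ℕ} (hru : r ≠ u) {c : Cmd} {t : ℕ}
    (Inv : ℕ → (ℕ → ℕ) × List ℕ → Prop) (hr : ∀ j x, Inv j x → x.1 r = j)
    (hc : ∀ j x, Inv (j + 1) x → ∃ y, Inv j y ∧
      c.Runs (Function.update (Function.update x.1 u 1) r j, x.2) t y) :
    ∀ n x, Inv n x → ∃ y, Inv 0 y ∧ (countdown r u c).Runs x (n * (t + 4) + 1) y := by
  intro n
  induction n with
  | zero =>
    intro x hx
    exact ⟨x, hx, (runs_loop_zero _ (hr _ _ hx)).mono (by omega)⟩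
  | succ n ih =>
    intro x hx
    obtain ⟨y, hy, h1⟩ := hc n x hx
    obtain ⟨z, hz, h2⟩ := ih y hy
    refine ⟨z, hz, ?_⟩
    have h0 := hr _ _ hx
    have h3 := runs_ops (l := [.const u 1, .sub r r u]) rfl x
    have h4 : [RAMInstr.const u 1, .sub r r u].foldl RAMInstr.act x =
        (Function.update (Function.update x.1 u 1) r n, x.2) := by
      simp [RAMInstr.act, RAMInstr.exec, hru, h0]
    rw [h4] at h3
    refine (runs_loop_step (by omega) (h3.seq h1) h2).mono ?_
    simp only [List.length_cons, List.length_nil]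
    ring_nf
    omega

end Cmd

/-! ### A language of bounded expressions -/

/-- Expressions for natural numbers. They may use numbered variables, look up entries of an input
table (`tab`), and form bounded sums; `sum i e f` is the sum of the values of `f` as variable `i`
runs through the numbers below the value of `e`. Expressions of kind `true` may moreover use the
entries of one working array (`arr`). In an expression `fix v l e q`, of kind `false`, the array is
`0` at first, then it is replaced repeatedly, `l` times, by the array that has the entry `1` at the
indices `v < l` for which `e` is not `0` and the entry `0` elsewhere; the value is that of `q` for
the final array. As `l`, `e` and `q` are of kind `true`, there is never more than one array in use.
-/
inductive Ex : Bool → Type where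
  | const {b : Bool} (c : ℕ) : Ex b
  | var {b : Bool} (i : ℕ) : Ex b
  | tab {b : Bool} (e : Ex b) : Ex b
  | arr (e : Ex true) : Ex true
  | add {b : Bool} (e f : Ex b) : Ex b
  | sub {b : Bool} (e f : Ex b) : Ex b
  | sum {b : Bool} (i : ℕ) (e f : Ex b) : Ex b
  | fix (v : ℕ) (l e q : Ex true) : Ex false

namespace Ex

/-- The value of an expression, for a given input table, given variables and a given array. -/
def eval (T : ℕ → ℕ) : {b : Bool} → Ex b → (ℕ → ℕ) → (ℕ → ℕ) → ℕ
  | _, const c, _, _ => c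
  | _, var i, x, _ => x i
  | _, tab e, x, A => T (e.eval T x A)
  | _, arr e, x, A => A (e.eval T x A)
  | _, add e f, x, A => e.eval T x A + f.eval T x A
  | _, sub e f, x, A => e.eval T x A - f.eval T x A
  | _, sum i e f, x, A =>
    ∑ j ∈ Finset.range (e.eval T x A), f.eval T (Function.update x i j) A
  | _, fix v l e q, x, A =>
    q.eval T x ((fun B j => if j < l.eval T x A then
      1 - (1 - e.eval T (Function.update x v j) B) else 0)^[l.eval T x A] 0)

/-- One round of the iteration in `fix v l e q`, where `n` is the value of `l`. -/
def round (T : ℕ → ℕ) (v n : ℕ) (e : Ex true) (x A : ℕ → ℕ) : ℕ → ℕ :=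
  fun j => if j < n then 1 - (1 - e.eval T (Function.update x v j) A) else 0

theorem eval_fix (T : ℕ → ℕ) (v : ℕ) (l e q : Ex true) (x A : ℕ → ℕ) :
    (fix v l e q).eval T x A = q.eval T x ((round T v (l.eval T x A) e x)^[l.eval T x A] 0) := rfl

open Polynomial in
/-- A polynomial bound for the value of an expression in terms of a bound for the input table,
if variable `i` is bounded by `β i` and all entries of the array are at most `1`. -/
noncomputable def bd : {b : Bool} → Ex b → (ℕ → ℕ[X]) → ℕ[X]
  | _, const c, _ => (c : ℕ[X])
  | _, var i, β => β i
  | _, tab _, _ => X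
  | _, arr _, _ => 1
  | _, add e f, β => e.bd β + f.bd β
  | _, sub e _, β => e.bd β
  | _, sum i e f, β => e.bd β * f.bd (Function.update β i (e.bd β))
  | _, fix _ _ _ q, β => q.bd β

theorem update_le_eval {x : ℕ → ℕ} {β : ℕ → Polynomial ℕ} {N : ℕ}
    (hx : ∀ i, x i ≤ (β i).eval N) {j : ℕ} {p : Polynomial ℕ} (hj : j ≤ p.eval N) (v i : ℕ) :
    Function.update x v j i ≤ (Function.update β v p i).eval N := by
  rcases eq_or_ne i v with rfl | h
  · simpa using hj
  · simpa [h] using hx i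

theorem round_le_one (T : ℕ → ℕ) (v n : ℕ) (e : Ex true) (x A : ℕ → ℕ) (j : ℕ) :
    round T v n e x A j ≤ 1 := by
  unfold round
  split_ifs <;> omega

theorem iterate_round_le_one (T : ℕ → ℕ) (v n : ℕ) (e : Ex true) (x : ℕ → ℕ) (t j : ℕ) :
    (round T v n e x)^[t] 0 j ≤ 1 := by
  cases t with
  | zero => simp
  | succ t =>
    rw [Function.iterate_succ_apply']
    exact round_le_one ..

theorem iterate_round_eq_zero (T : ℕ → ℕ) (v n : ℕ) (e : Ex true) (x : ℕ → ℕ) (t : ℕ) {j : ℕ}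
    (hj : n ≤ j) : (round T v n e x)^[t] 0 j = 0 := by
  cases t with
  | zero => simp
  | succ t =>
    rw [Function.iterate_succ_apply', round, if_neg (by omega)]

theorem eval_le_bd {T : ℕ → ℕ} {N : ℕ} (hT : ∀ a, T a ≤ N) {b : Bool} (e : Ex b) :
    ∀ {x A : ℕ → ℕ} {β : ℕ → Polynomial ℕ}, (∀ a, A a ≤ 1) → (∀ i, x i ≤ (β i).eval N) →
      e.eval T x A ≤ (e.bd β).eval N := by
  induction e with
  | const c => intro x A β _ _; simp [eval, bd]
  | var i => intro x A β _ hx; exact hx i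
  | tab e _ => intro x A β _ _; simpa [eval, bd] using hT _
  | arr e _ => intro x A β hA _; simpa [eval, bd] using hA _
  | add e f he hf =>
    intro x A β hA hx
    simp only [eval, bd, Polynomial.eval_add]
    exact add_le_add (he hA hx) (hf hA hx)
  | sub e f he hf =>
    intro x A β hA hx
    simp only [eval, bd]
    exact (Nat.sub_le _ _).trans (he hA hx)
  | sum i e f he hf =>
    intro x A β hA hx
    simp only [eval, bd, Polynomial.eval_mul]
    have h1 := he hA hx
    refine (Finset.sum_le_card_nsmul _ _ ((f.bd (Function.update β i (e.bd β))).eval N) ?_).trans ?_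
    · intro j hj
      exact hf hA (update_le_eval hx ((Finset.mem_range.1 hj).le.trans h1) i)
    · rw [Finset.card_range, smul_eq_mul]
      exact Nat.mul_le_mul_right _ h1
  | fix v l e q _ _ hq =>
    intro x A β hA hx
    rw [eval_fix, bd]
    exact hq (iterate_round_le_one _ _ _ _ _ _) hx

/-! ### Compilation of expressions

The registers are divided up as follows: variable `i` is kept in register `8 * i`, entry `a` of the
input table in register `4 * a + 1`, entry `a` of the working array in register `4 * a + 2`, entry
`a` of a buffer for the next array in register `4 * a + 3`, and there are auxiliary registers with
the numbers `8 * d + 4`. -/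

/-- Instructions that neither jump nor read from the input. -/
def IsQuiet : RAMInstr → Bool
  | .const .. | .add .. | .sub .. | .load .. | .store .. => true
  | _ => false

/-- The effect of an instruction that neither jumps nor reads on the registers. -/
def effect (x : ℕ → ℕ) : RAMInstr → ℕ → ℕ
  | .const i v => Function.update x i v
  | .add i a b => Function.update x i (x a + x b)
  | .sub i a b => Function.update x i (x a - x b)
  | .load i a => Function.update x i (x (x a))
  | .store i a => Function.update x (x i) (x a)
  | _ => x

/-- The effect of a block of instructions that neither jump nor read on the registers. -/
def after (l : List RAMInstr) (x : ℕ → ℕ) : ℕ → ℕ := l.foldl effect x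

theorem after_append (l l' : List RAMInstr) (x : ℕ → ℕ) :
    after (l ++ l') x = after l' (after l x) := List.foldl_append

theorem after_cons (I : RAMInstr) (l : List RAMInstr) (x : ℕ → ℕ) :
    after (I :: l) x = after l (effect x I) := rfl

theorem after_nil (x : ℕ → ℕ) : after [] x = x := rfl

theorem runs_after {l : List RAMInstr} (hl : l.all IsQuiet = true) (x : ℕ → ℕ)
    (inp : List ℕ) : (Cmd.ops l).Runs (x, inp) l.length (after l x, inp) := by
  have h1 : l.all RAMInstr.IsPlain = true := by
    rw [List.all_eq_true] at hl ⊢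
    intro I hI
    have := hl I hI
    cases I <;> simp_all [IsQuiet, RAMInstr.IsPlain]
  have h2 : ∀ x : ℕ → ℕ, l.foldl RAMInstr.act (x, inp) = (after l x, inp) := by
    clear h1
    induction l with
    | nil => intro x; rfl
    | cons I l ih =>
      intro x
      rw [List.all_cons, Bool.and_eq_true] at hl
      have h3 : I.act (x, inp) = (effect x I, inp) := by
        cases I <;> first | rfl | exact absurd hl.1 (by simp [IsQuiet])
      rw [List.foldl_cons, h3, ih hl.2, after_cons]
  have h3 := Cmd.runs_ops h1 (x, inp)
  rwa [h2] at h3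

/-- Copy register `a` to register `i`. -/
def move (i a : ℕ) : List RAMInstr := [.const i 0, .add i i a]

/-- Set register `i` to `4 * R a + c`. Register `i + 8` is overwritten with `c`. -/
def addr (i a c : ℕ) : List RAMInstr :=
  [.add i a a, .add i i i, .const (i + 8) c, .add i i (i + 8)]

theorem after_move {i a : ℕ} (h : a ≠ i) (x : ℕ → ℕ) :
    after (move i a) x = Function.update x i (x a) := by
  simp [move, after, effect, h]

theorem after_addr (i a c : ℕ) (x : ℕ → ℕ) :
    after (addr i a c) x = Function.update (Function.update x (i + 8) c) i (4 * x a + c) := by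
  funext r
  simp only [addr, after, effect, List.foldl, Function.update_apply]
  split_ifs <;> omega

/-- Fill the buffer with the bits that say whether an expression is different from `0`, for all
values of variable `v` below the content of register `8 * d + 4`. The argument `c` is the compiled
expression, with its value in register `8 * (d + 3) + 4`. The two subtractions from `1` turn the
value into a bit. -/
def fillBuf (v d : ℕ) (c : Cmd) : Cmd :=
  (Cmd.ops (move (8 * v) (8 * d + 4))).seq
    (Cmd.countdown (8 * v) (8 * (d + 3) + 4) (c.seq (Cmd.ops (
      [.const (8 * (d + 4) + 4) 1,
       .sub (8 * (d + 3) + 4) (8 * (d + 4) + 4) (8 * (d + 3) + 4),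
       .sub (8 * (d + 3) + 4) (8 * (d + 4) + 4) (8 * (d + 3) + 4)] ++
      addr (8 * (d + 4) + 4) (8 * v) 3 ++
      [.store (8 * (d + 4) + 4) (8 * (d + 3) + 4)]))))

/-- Copy the buffer to the array, for the indices below the content of register `8 * d + 4`. -/
def copyBuf (d : ℕ) : Cmd :=
  (Cmd.ops (move (8 * (d + 3) + 4) (8 * d + 4))).seq
    (Cmd.countdown (8 * (d + 3) + 4) (8 * (d + 4) + 4) (Cmd.ops (
      addr (8 * (d + 4) + 4) (8 * (d + 3) + 4) 3 ++
      [.load (8 * (d + 6) + 4) (8 * (d + 4) + 4)] ++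
      addr (8 * (d + 4) + 4) (8 * (d + 3) + 4) 2 ++
      [.store (8 * (d + 4) + 4) (8 * (d + 6) + 4)])))

/-- Set the array to `0`, for the indices below the content of register `8 * d + 4`. -/
def clearArr (d : ℕ) : Cmd :=
  (Cmd.ops (move (8 * (d + 3) + 4) (8 * d + 4))).seq
    (Cmd.countdown (8 * (d + 3) + 4) (8 * (d + 4) + 4) (Cmd.ops (
      addr (8 * (d + 4) + 4) (8 * (d + 3) + 4) 2 ++
      [.const (8 * (d + 6) + 4) 0, .store (8 * (d + 4) + 4) (8 * (d + 6) + 4)])))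

/-- A program that puts the value of an expression into register `8 * d + 4` and that uses only
auxiliary registers from this one on. -/
def comp : {b : Bool} → Ex b → ℕ → Cmd
  | _, const c, d => .ops [.const (8 * d + 4) c]
  | _, var i, d => .ops (move (8 * d + 4) (8 * i))
  | _, tab e, d => (e.comp (d + 1)).seq
      (.ops (addr (8 * d + 4) (8 * (d + 1) + 4) 1 ++ [.load (8 * d + 4) (8 * d + 4)]))
  | _, arr e, d => (e.comp (d + 1)).seq
      (.ops (addr (8 * d + 4) (8 * (d + 1) + 4) 2 ++ [.load (8 * d + 4) (8 * d + 4)]))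
  | _, add e f, d => ((e.comp d).seq (f.comp (d + 1))).seq
      (.ops [.add (8 * d + 4) (8 * d + 4) (8 * (d + 1) + 4)])
  | _, sub e f, d => ((e.comp d).seq (f.comp (d + 1))).seq
      (.ops [.sub (8 * d + 4) (8 * d + 4) (8 * (d + 1) + 4)])
  | _, sum i e f, d =>
      (((e.comp d).seq
        (.ops (move (8 * (d + 1) + 4) (8 * i) ++ [.const (8 * (d + 2) + 4) 0] ++
          move (8 * i) (8 * d + 4)))).seq
        (.countdown (8 * i) (8 * (d + 3) + 4) ((f.comp (d + 3)).seq
          (.ops [.add (8 * (d + 2) + 4) (8 * (d + 2) + 4) (8 * (d + 3) + 4)])))).seq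
        (.ops (move (8 * i) (8 * (d + 1) + 4) ++ move (8 * d + 4) (8 * (d + 2) + 4)))
  | _, fix v l e q, d =>
      ((((((l.comp d).seq
        (.ops (move (8 * (d + 1) + 4) (8 * v) ++ move (8 * (d + 2) + 4) (8 * d + 4)))).seq
        (.countdown (8 * (d + 2) + 4) (8 * (d + 3) + 4)
          ((fillBuf v d (e.comp (d + 3))).seq (copyBuf d)))).seq
        (.ops (move (8 * v) (8 * (d + 1) + 4)))).seq
        (q.comp (d + 2))).seq
        (clearArr d)).seq
        (.ops (move (8 * d + 4) (8 * (d + 2) + 4)))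

/-- A polynomial bound for the running time of `comp`, under the assumptions of `bd`. -/
noncomputable def tm : {b : Bool} → Ex b → (ℕ → Polynomial ℕ) → Polynomial ℕ
  | _, const _, _ => 1
  | _, var _, _ => 2
  | _, tab e, β => e.tm β + 5
  | _, arr e, β => e.tm β + 5
  | _, add e f, β => e.tm β + f.tm β + 1
  | _, sub e f, β => e.tm β + f.tm β + 1
  | _, sum i e f, β =>
      e.tm β + 5 + (e.bd β * (f.tm (Function.update β i (e.bd β)) + 1 + 4) + 1) + 4
  | _, fix v l e q, β =>
      l.tm β + 4 + (l.bd β * ((2 + (l.bd β * (e.tm (Function.update β v (l.bd β)) + 8 + 4) + 1) +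
        (2 + (l.bd β * (10 + 4) + 1))) + 4) + 1) + 2 + q.tm β + (2 + (l.bd β * (6 + 4) + 1)) + 2

/-- The registers of `x` and `y` agree outside the auxiliary registers from number `8 * d + 4` on
and, if `b` is `false`, outside the buffer. -/
def Frame (b : Bool) (d : ℕ) (x y : ℕ → ℕ) : Prop :=
  ∀ r, (b = false → r % 4 ≠ 3) → (r % 8 = 4 → r < 8 * d + 4) → y r = x r

/-- The registers `x` with the array replaced by `A`. -/
def setArr (x A : ℕ → ℕ) : ℕ → ℕ := fun r => if r % 4 = 2 then A (r / 4) else x r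

/-- The variables, as functions of the registers. -/
def varsOf (x : ℕ → ℕ) : ℕ → ℕ := fun i => x (8 * i)

/-- The input table, as a function of the registers. -/
def tabOf (x : ℕ → ℕ) : ℕ → ℕ := fun a => x (4 * a + 1)

/-- The working array, as a function of the registers. -/
def arrOf (x : ℕ → ℕ) : ℕ → ℕ := fun a => x (4 * a + 2)

theorem Frame.trans {b : Bool} {d : ℕ} {x y z : ℕ → ℕ} (h : Frame b d x y) (h' : Frame b d y z) :
    Frame b d x z := fun r h1 h2 => (h' r h1 h2).trans (h r h1 h2)

theorem Frame.weaken {b : Bool} {d : ℕ} {x y : ℕ → ℕ} (h : Frame b d x y) : Frame false d x y :=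
  fun r h1 h2 => h r (fun _ => h1 rfl) h2

theorem Frame.varsOf_eq {b : Bool} {d : ℕ} {x y : ℕ → ℕ} (h : Frame b d x y) :
    varsOf y = varsOf x :=
  funext fun i => h (8 * i) (by omega) (by omega)

theorem Frame.tabOf_eq {b : Bool} {d : ℕ} {x y : ℕ → ℕ} (h : Frame b d x y) :
    tabOf y = tabOf x :=
  funext fun i => h (4 * i + 1) (by omega) (by omega)

theorem Frame.arrOf_eq {b : Bool} {d : ℕ} {x y : ℕ → ℕ} (h : Frame b d x y) :
    arrOf y = arrOf x :=
  funext fun i => h (4 * i + 2) (by omega) (by omega)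

theorem varsOf_update (x : ℕ → ℕ) (i j : ℕ) :
    varsOf (Function.update x (8 * i) j) = Function.update (varsOf x) i j := by
  funext a
  simp [varsOf, Function.update_apply]

theorem tabOf_update (x : ℕ → ℕ) (i j : ℕ) : tabOf (Function.update x (8 * i) j) = tabOf x := by
  funext a
  simp only [tabOf, Function.update_apply]
  rw [if_neg (by omega)]

theorem arrOf_update (x : ℕ → ℕ) (i j : ℕ) : arrOf (Function.update x (8 * i) j) = arrOf x := by
  funext a
  simp only [arrOf, Function.update_apply]
  rw [if_neg (by omega)]

theorem varsOf_setArr (x A : ℕ → ℕ) : varsOf (setArr x A) = varsOf x := by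
  funext a
  simp only [varsOf, setArr]
  rw [if_neg (by omega)]

theorem tabOf_setArr (x A : ℕ → ℕ) : tabOf (setArr x A) = tabOf x := by
  funext a
  simp only [tabOf, setArr]
  rw [if_neg (by omega)]

theorem arrOf_setArr (x A : ℕ → ℕ) : arrOf (setArr x A) = A := by
  funext a
  simp only [arrOf, setArr]
  rw [if_pos (by omega)]
  congr 1
  omega

/-- What a compiled expression does: with the input table bounded by `N`, and the variables by
`β`, the program computes the right value within the right time and leaves the frame alone. -/
def CompSpec {b : Bool} (e : Ex b) : Prop :=
  ∀ (d N : ℕ) (β : ℕ → Polynomial ℕ) (x : ℕ → ℕ) (inp : List ℕ), (b = false → arrOf x = 0) →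
    (∀ a, arrOf x a ≤ 1) → (∀ a, tabOf x a ≤ N) → (∀ i, varsOf x i ≤ (β i).eval N) →
    ∃ y, Frame b d x y ∧ y (8 * d + 4) = e.eval (tabOf x) (varsOf x) (arrOf x) ∧
      (e.comp d).Runs (x, inp) ((e.tm β).eval N) (y, inp)

theorem compSpec_const {b : Bool} (c : ℕ) : CompSpec (const c : Ex b) := by
  intro d N β x inp _ _ _ _
  refine ⟨after [.const (8 * d + 4) c] x, ?_, ?_, (runs_after rfl x inp).mono (by simp [tm])⟩
  · intro r h1 h2
    simp (disch := omega) only [after_cons, after_nil, effect, Function.update_of_ne]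
  · simp [after_cons, after_nil, effect, eval]

theorem compSpec_var {b : Bool} (i : ℕ) : CompSpec (var i : Ex b) := by
  intro d N β x inp _ _ _ _
  refine ⟨after (move (8 * d + 4) (8 * i)) x, ?_, ?_, (runs_after rfl x inp).mono
    (by simp [tm, move])⟩
  · intro r h1 h2
    simp (disch := omega) only [after_move, Function.update_of_ne]
  · simp (disch := omega) only [after_move, Function.update_self, eval, varsOf]

theorem compSpec_tab {b : Bool} {e : Ex b} (he : CompSpec e) : CompSpec (tab e) := by
  intro d N β x inp h0 h1 h2 h3
  obtain ⟨y, hy, hv, hr⟩ := he (d + 1) N β x inp h0 h1 h2 h3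
  refine ⟨after (addr (8 * d + 4) (8 * (d + 1) + 4) 1 ++ [RAMInstr.load (8 * d + 4) (8 * d + 4)]) y,
    ?_, ?_, (hr.seq (runs_after rfl y inp)).mono (by simp [tm, addr])⟩
  · intro r h1 h2
    simp (disch := omega) only [after_append, after_addr, after_cons, after_nil, effect,
      Function.update_of_ne]
    exact hy r h1 (by omega)
  · simp (disch := omega) only [after_append, after_addr, after_cons, after_nil, effect,
      Function.update_self, Function.update_of_ne, eval]
    rw [hv, ← hy.tabOf_eq]
    rfl

theorem compSpec_arr {e : Ex true} (he : CompSpec e) : CompSpec (arr e) := by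
  intro d N β x inp h0 h1 h2 h3
  obtain ⟨y, hy, hv, hr⟩ := he (d + 1) N β x inp h0 h1 h2 h3
  refine ⟨after (addr (8 * d + 4) (8 * (d + 1) + 4) 2 ++ [RAMInstr.load (8 * d + 4) (8 * d + 4)]) y,
    ?_, ?_, (hr.seq (runs_after rfl y inp)).mono (by simp [tm, addr])⟩
  · intro r h1 h2
    simp (disch := omega) only [after_append, after_addr, after_cons, after_nil, effect,
      Function.update_of_ne]
    exact hy r h1 (by omega)
  · simp (disch := omega) only [after_append, after_addr, after_cons, after_nil, effect,
      Function.update_self, Function.update_of_ne, eval]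
    rw [hv, ← hy.arrOf_eq]
    rfl

theorem compSpec_add {b : Bool} {e f : Ex b} (he : CompSpec e) (hf : CompSpec f) :
    CompSpec (add e f) := by
  intro d N β x inp h0 h1 h2 h3
  obtain ⟨y, hy, hv, hr⟩ := he d N β x inp h0 h1 h2 h3
  rw [← hy.varsOf_eq] at h3
  rw [← hy.tabOf_eq] at h2
  rw [← hy.arrOf_eq] at h0 h1
  obtain ⟨z, hz, hw, hs⟩ := hf (d + 1) N β y inp h0 h1 h2 h3
  refine ⟨after [.add (8 * d + 4) (8 * d + 4) (8 * (d + 1) + 4)] z, ?_, ?_,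
    ((hr.seq hs).seq (runs_after rfl z inp)).mono (by simp [tm])⟩
  · refine hy.trans fun r h1 h2 => ?_
    simp (disch := omega) only [after_cons, after_nil, effect, Function.update_of_ne]
    exact hz r h1 (by omega)
  · simp (disch := omega) only [after_cons, after_nil, effect, Function.update_self, eval]
    rw [hw, hz _ (by omega) (by omega), hv, hy.tabOf_eq, hy.varsOf_eq, hy.arrOf_eq]

theorem compSpec_sub {b : Bool} {e f : Ex b} (he : CompSpec e) (hf : CompSpec f) :
    CompSpec (sub e f) := by
  intro d N β x inp h0 h1 h2 h3
  obtain ⟨y, hy, hv, hr⟩ := he d N β x inp h0 h1 h2 h3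
  rw [← hy.varsOf_eq] at h3
  rw [← hy.tabOf_eq] at h2
  rw [← hy.arrOf_eq] at h0 h1
  obtain ⟨z, hz, hw, hs⟩ := hf (d + 1) N β y inp h0 h1 h2 h3
  refine ⟨after [.sub (8 * d + 4) (8 * d + 4) (8 * (d + 1) + 4)] z, ?_, ?_,
    ((hr.seq hs).seq (runs_after rfl z inp)).mono (by simp [tm])⟩
  · refine hy.trans fun r h1 h2 => ?_
    simp (disch := omega) only [after_cons, after_nil, effect, Function.update_of_ne]
    exact hz r h1 (by omega)
  · simp (disch := omega) only [after_cons, after_nil, effect, Function.update_self, eval]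
    rw [hw, hz _ (by omega) (by omega), hv, hy.tabOf_eq, hy.varsOf_eq, hy.arrOf_eq]

theorem compSpec_sum {b : Bool} {i : ℕ} {e f : Ex b} (he : CompSpec e) (hf : CompSpec f) :
    CompSpec (sum i e f) := by
  intro d N β x inp h0 h1 h2 h3
  obtain ⟨y, hy, hv, hr⟩ := he d N β x inp h0 h1 h2 h3
  set n := e.eval (tabOf x) (varsOf x) (arrOf x) with hn
  have hnb : n ≤ (e.bd β).eval N := eval_le_bd h2 e h1 h3
  -- `g j` is the summand for `j`.
  set g : ℕ → ℕ := fun j => f.eval (tabOf x) (Function.update (varsOf x) i j) (arrOf x) with hg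
  set l : List RAMInstr := move (8 * (d + 1) + 4) (8 * i) ++ [.const (8 * (d + 2) + 4) 0] ++
    move (8 * i) (8 * d + 4) with hl
  let Inv : ℕ → (ℕ → ℕ) × List ℕ → Prop := fun j z => z.2 = inp ∧
    Frame b d (Function.update x (8 * i) j) z.1 ∧ z.1 (8 * (d + 1) + 4) = x (8 * i) ∧
    z.1 (8 * (d + 2) + 4) + ∑ a ∈ Finset.range j, g a = ∑ a ∈ Finset.range n, g a
  have hstart : Inv n (after l y, inp) := by
    refine ⟨rfl, ?_, ?_, ?_⟩
    · intro r h1 h2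
      rcases eq_or_ne r (8 * i) with rfl | hne
      · simp (disch := omega) only [hl, after_append, after_move, after_cons, after_nil, effect,
          Function.update_of_ne, Function.update_self, hv]
      · simp (disch := omega) only [hl, after_append, after_move, after_cons, after_nil, effect,
          Function.update_of_ne]
        exact hy r h1 h2
    · simp (disch := omega) only [hl, after_append, after_move, after_cons, after_nil, effect,
        Function.update_of_ne, Function.update_self]
      exact hy _ (by omega) (by omega)
    · simp (disch := omega) only [hl, after_append, after_move, after_cons, after_nil, effect,
        Function.update_of_ne, Function.update_self, zero_add]
  have hloop := Cmd.runs_countdown (r := 8 * i) (u := 8 * (d + 3) + 4) (by omega)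
    (c := (f.comp (d + 3)).seq
      (.ops [.add (8 * (d + 2) + 4) (8 * (d + 2) + 4) (8 * (d + 3) + 4)]))
    (t := (f.tm (Function.update β i (e.bd β))).eval N + 1) (fun j z => j ≤ n ∧ Inv j z)
    (fun j z hz => by simpa using hz.2.2.1 (8 * i) (by omega) (by omega))
    (fun j z hz => by
      obtain ⟨hjn, hzi, hzf, hz1, hz2⟩ := hz
      set w := Function.update (Function.update z.1 (8 * (d + 3) + 4) 1) (8 * i) j with hw
      have hwf : Frame b d (Function.update x (8 * i) j) w := by
        intro r h1 h2
        rcases eq_or_ne r (8 * i) with rfl | hne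
        · simp [hw]
        · have := hzf r h1 h2
          simp (disch := omega) only [Function.update_of_ne, hw] at this ⊢
          exact this
      have e1 : tabOf w = tabOf x := by rw [hwf.tabOf_eq, tabOf_update]
      have e2 : varsOf w = Function.update (varsOf x) i j := by rw [hwf.varsOf_eq, varsOf_update]
      have e3 : arrOf w = arrOf x := by rw [hwf.arrOf_eq, arrOf_update]
      obtain ⟨v, hvf, hvv, hvr⟩ := hf (d + 3) N (Function.update β i (e.bd β)) w z.2
        (by rwa [e3]) (by rwa [e3]) (by rwa [e1])
        (by rw [e2]; exact update_le_eval h3 (by omega) i)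
      rw [e1, e2, e3] at hvv
      refine ⟨(after [.add (8 * (d + 2) + 4) (8 * (d + 2) + 4) (8 * (d + 3) + 4)] v, z.2),
        ⟨by omega, hzi, ?_, ?_, ?_⟩, hvr.seq (runs_after rfl v z.2)⟩
      · refine hwf.trans fun r h1 h2 => ?_
        simp (disch := omega) only [after_cons, after_nil, effect, Function.update_of_ne]
        exact hvf r h1 (by omega)
      · simp (disch := omega) only [after_cons, after_nil, effect, Function.update_of_ne]
        rw [hvf _ (by omega) (by omega)]
        simp (disch := omega) only [hw, Function.update_of_ne]
        exact hz1
      · simp (disch := omega) only [after_cons, after_nil, effect, Function.update_self]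
        rw [hvf _ (by omega) (by omega), hvv]
        simp (disch := omega) only [hw, Function.update_of_ne]
        rw [Finset.sum_range_succ] at hz2
        simp only [hg] at hz2 ⊢
        omega)
    n (after l y, inp) ⟨le_rfl, hstart⟩
  obtain ⟨⟨z, inp'⟩, ⟨-, hzi, hzf, hz1, hz2⟩, hzr⟩ := hloop
  simp only at hzi hzf hz1 hz2
  subst hzi
  refine ⟨after (move (8 * i) (8 * (d + 1) + 4) ++ move (8 * d + 4) (8 * (d + 2) + 4)) z, ?_, ?_,
    (((hr.seq (runs_after rfl y inp')).seq hzr).seq (runs_after rfl z inp')).mono ?_⟩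
  · intro r h1 h2
    rcases eq_or_ne r (8 * i) with rfl | hne
    · simp (disch := omega) only [after_append, after_move, Function.update_of_ne,
        Function.update_self]
      exact hz1
    · have := hzf r h1 h2
      simp (disch := omega) only [after_append, after_move, Function.update_of_ne] at this ⊢
      exact this
  · simp (disch := omega) only [after_append, after_move, Function.update_of_ne,
        Function.update_self]
    simpa [eval] using hz2
  · simp only [tm, Polynomial.eval_add, Polynomial.eval_mul, Polynomial.eval_one,
      Polynomial.eval_ofNat]
    have := Nat.mul_le_mul_right
      ((f.tm (Function.update β i (e.bd β))).eval N + 1 + 4) hnb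
    simp only [hl, move, List.length_append, List.length_cons, List.length_nil]
    omega

theorem fillBuf_runs {v d n N : ℕ} {e : Ex true} (he : CompSpec e) (β : ℕ → Polynomial ℕ)
    (x : ℕ → ℕ) (inp : List ℕ) (hn : x (8 * d + 4) = n) (h1 : ∀ a, arrOf x a ≤ 1)
    (h2 : ∀ a, tabOf x a ≤ N)
    (h3 : ∀ j < n, ∀ i, Function.update (varsOf x) v j i ≤ (β i).eval N) :
    ∃ y, Frame false (d + 3) (Function.update x (8 * v) 0) y ∧
      (∀ a < n, y (4 * a + 3) = round (tabOf x) v n e (varsOf x) (arrOf x) a) ∧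
      (fillBuf v d (e.comp (d + 3))).Runs (x, inp)
        (2 + (n * ((e.tm β).eval N + 8 + 4) + 1)) (y, inp) := by
  set l : List RAMInstr := [.const (8 * (d + 4) + 4) 1,
       .sub (8 * (d + 3) + 4) (8 * (d + 4) + 4) (8 * (d + 3) + 4),
       .sub (8 * (d + 3) + 4) (8 * (d + 4) + 4) (8 * (d + 3) + 4)] ++
      addr (8 * (d + 4) + 4) (8 * v) 3 ++
      [.store (8 * (d + 4) + 4) (8 * (d + 3) + 4)] with hl
  have hloop := Cmd.runs_countdown (r := 8 * v) (u := 8 * (d + 3) + 4) (by omega)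
    (c := (e.comp (d + 3)).seq (.ops l)) (t := (e.tm β).eval N + 8)
    (fun j z => j ≤ n ∧ z.2 = inp ∧ Frame false (d + 3) (Function.update x (8 * v) j) z.1 ∧
      ∀ a, j ≤ a → a < n → z.1 (4 * a + 3) = round (tabOf x) v n e (varsOf x) (arrOf x) a)
    (fun j z hz => by simpa using hz.2.2.1 (8 * v) (by omega) (by omega))
    (fun j z hz => by
      obtain ⟨hjn, hzi, hzf, hzb⟩ := hz
      set w := Function.update (Function.update z.1 (8 * (d + 3) + 4) 1) (8 * v) j with hw
      have hwf : Frame false (d + 3) (Function.update x (8 * v) j) w := by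
        intro r h1 h2
        rcases eq_or_ne r (8 * v) with rfl | hne
        · simp [hw]
        · have := hzf r h1 h2
          simp (disch := omega) only [Function.update_of_ne, hw] at this ⊢
          exact this
      have e1 : tabOf w = tabOf x := by rw [hwf.tabOf_eq, tabOf_update]
      have e2 : varsOf w = Function.update (varsOf x) v j := by rw [hwf.varsOf_eq, varsOf_update]
      have e3 : arrOf w = arrOf x := by rw [hwf.arrOf_eq, arrOf_update]
      obtain ⟨y, hyf, hyv, hyr⟩ := he (d + 3) N β w z.2
        (by simp) (by rwa [e3]) (by rwa [e1]) (by rw [e2]; exact h3 j (by omega))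
      rw [e1, e2, e3] at hyv
      have hyi : y (8 * v) = j := by
        rw [hyf _ (by omega) (by omega), hw, Function.update_self]
      refine ⟨(after l y, z.2), ⟨by omega, hzi, ?_, ?_⟩, hyr.seq (runs_after rfl y z.2)⟩
      · refine hwf.trans fun r h1 h2 => ?_
        have h4 := h1 rfl
        simp (disch := omega) only [hl, after_append, after_addr, after_cons, after_nil, effect,
          Function.update_of_ne, Function.update_self]
        exact hyf r (by simp) (by omega)
      · intro a ha han
        rcases eq_or_ne a j with rfl | hne
        · simp (disch := omega) only [hl, after_append, after_addr, after_cons, after_nil, effect,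
            Function.update_of_ne, Function.update_self, hyi, hyv, round, if_pos han]
        · simp (disch := omega) only [hl, after_append, after_addr, after_cons, after_nil, effect,
            Function.update_of_ne, Function.update_self, hyi]
          rw [hyf _ (by simp) (by omega)]
          simp (disch := omega) only [hw, Function.update_of_ne]
          exact hzb a (by omega) han)
    n (after (move (8 * v) (8 * d + 4)) x, inp) ⟨le_rfl, rfl, by
      intro r h1 h2
      rw [after_move (by omega), hn], by omega⟩
  obtain ⟨⟨z, inp'⟩, ⟨-, hzi, hzf, hzb⟩, hzr⟩ := hloop
  simp only at hzi hzf hzb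
  subst hzi
  exact ⟨z, hzf, fun a => hzb a (Nat.zero_le a), (runs_after rfl x inp').seq hzr⟩

theorem copyBuf_runs {d n : ℕ} (x : ℕ → ℕ) (inp : List ℕ) (hn : x (8 * d + 4) = n) :
    ∃ y, Frame false (d + 3)
        (setArr x fun a => if a < n then x (4 * a + 3) else x (4 * a + 2)) y ∧
      (copyBuf d).Runs (x, inp) (2 + (n * (10 + 4) + 1)) (y, inp) := by
  set l : List RAMInstr := addr (8 * (d + 4) + 4) (8 * (d + 3) + 4) 3 ++
      [.load (8 * (d + 6) + 4) (8 * (d + 4) + 4)] ++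
      addr (8 * (d + 4) + 4) (8 * (d + 3) + 4) 2 ++
      [.store (8 * (d + 4) + 4) (8 * (d + 6) + 4)] with hl
  have hloop := Cmd.runs_countdown (r := 8 * (d + 3) + 4) (u := 8 * (d + 4) + 4) (by omega)
    (c := .ops l) (t := 10)
    (fun j z => j ≤ n ∧ z.2 = inp ∧ z.1 (8 * (d + 3) + 4) = j ∧ Frame true (d + 3)
      (setArr x fun a => if j ≤ a ∧ a < n then x (4 * a + 3) else x (4 * a + 2)) z.1)
    (fun j z hz => hz.2.2.1)
    (fun j z hz => by
      obtain ⟨hjn, hzi, hzj, hzf⟩ := hz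
      refine ⟨(after l (Function.update (Function.update z.1 (8 * (d + 4) + 4) 1)
        (8 * (d + 3) + 4) j), z.2), ⟨by omega, hzi, ?_, ?_⟩, runs_after rfl _ z.2⟩
      · simp (disch := omega) only [hl, after_append, after_addr, after_cons, after_nil, effect,
          Function.update_of_ne, Function.update_self]
      · intro r h1 h2
        have hb := hzf (4 * j + 3) (by simp) (by omega)
        simp (disch := omega) only [setArr, if_neg] at hb
        have hr := hzf r h1 h2
        simp only [setArr] at hr ⊢
        rcases eq_or_ne r (4 * j + 2) with rfl | hne
        · simp (disch := omega) only [hl, after_append, after_addr, after_cons, after_nil, effect,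
            Function.update_of_ne, Function.update_self, if_pos, hb]
          congr 1
          omega
        · simp (disch := omega) only [hl, after_append, after_addr, after_cons, after_nil, effect,
            Function.update_of_ne, Function.update_self]
          rw [hr]
          split_ifs <;> first | rfl | omega)
    n (after (move (8 * (d + 3) + 4) (8 * d + 4)) x, inp) ⟨le_rfl, rfl, by
      dsimp only
      rw [after_move (by omega), Function.update_self, hn], by
      intro r h1 h2
      dsimp only
      rw [after_move (by omega), Function.update_of_ne (by omega), setArr]
      split_ifs <;> first | rfl | omega | (congr 1; omega)⟩
  obtain ⟨⟨z, inp'⟩, ⟨-, hzi, -, hzf⟩, hzr⟩ := hloop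
  simp only at hzi hzf
  subst hzi
  simp only [Nat.zero_le, true_and] at hzf
  exact ⟨z, hzf.weaken, (runs_after rfl x inp').seq hzr⟩

theorem clearArr_runs {d n : ℕ} (x : ℕ → ℕ) (inp : List ℕ) (hn : x (8 * d + 4) = n) :
    ∃ y, Frame false (d + 3) (setArr x fun a => if a < n then 0 else x (4 * a + 2)) y ∧
      (clearArr d).Runs (x, inp) (2 + (n * (6 + 4) + 1)) (y, inp) := by
  set l : List RAMInstr := addr (8 * (d + 4) + 4) (8 * (d + 3) + 4) 2 ++
      [.const (8 * (d + 6) + 4) 0, .store (8 * (d + 4) + 4) (8 * (d + 6) + 4)] with hl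
  have hloop := Cmd.runs_countdown (r := 8 * (d + 3) + 4) (u := 8 * (d + 4) + 4) (by omega)
    (c := .ops l) (t := 6)
    (fun j z => j ≤ n ∧ z.2 = inp ∧ z.1 (8 * (d + 3) + 4) = j ∧ Frame true (d + 3)
      (setArr x fun a => if j ≤ a ∧ a < n then 0 else x (4 * a + 2)) z.1)
    (fun j z hz => hz.2.2.1)
    (fun j z hz => by
      obtain ⟨hjn, hzi, hzj, hzf⟩ := hz
      refine ⟨(after l (Function.update (Function.update z.1 (8 * (d + 4) + 4) 1)
        (8 * (d + 3) + 4) j), z.2), ⟨by omega, hzi, ?_, ?_⟩, runs_after rfl _ z.2⟩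
      · simp (disch := omega) only [hl, after_append, after_addr, after_cons, after_nil, effect,
          Function.update_of_ne, Function.update_self]
      · intro r h1 h2
        have hr := hzf r h1 h2
        simp only [setArr] at hr ⊢
        rcases eq_or_ne r (4 * j + 2) with rfl | hne
        · simp (disch := omega) only [hl, after_append, after_addr, after_cons, after_nil, effect,
            Function.update_of_ne, Function.update_self, if_pos]
        · simp (disch := omega) only [hl, after_append, after_addr, after_cons, after_nil, effect,
            Function.update_of_ne, Function.update_self]
          rw [hr]
          split_ifs <;> first | rfl | omega)
    n (after (move (8 * (d + 3) + 4) (8 * d + 4)) x, inp) ⟨le_rfl, rfl, by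
      dsimp only
      rw [after_move (by omega), Function.update_self, hn], by
      intro r h1 h2
      dsimp only
      rw [after_move (by omega), Function.update_of_ne (by omega), setArr]
      split_ifs <;> first | rfl | omega | (congr 1; omega)⟩
  obtain ⟨⟨z, inp'⟩, ⟨-, hzi, -, hzf⟩, hzr⟩ := hloop
  simp only at hzi hzf
  subst hzi
  simp only [Nat.zero_le, true_and] at hzf
  exact ⟨z, hzf.weaken, (runs_after rfl x inp').seq hzr⟩

theorem round_update (T : ℕ → ℕ) (v n : ℕ) (e : Ex true) (x A : ℕ → ℕ) (j : ℕ) :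
    round T v n e (Function.update x v j) A = round T v n e x A := by
  funext a
  simp [round]

theorem compSpec_fix {v : ℕ} {l e q : Ex true} (hl : CompSpec l) (he : CompSpec e)
    (hq : CompSpec q) : CompSpec (fix v l e q) := by
  intro d N β x inp h0 h1 h2 h3
  have hA0 := h0 rfl
  obtain ⟨y, hy, hv, hr⟩ := hl d N β x inp (by simp) h1 h2 h3
  set n := l.eval (tabOf x) (varsOf x) (arrOf x) with hn
  have hnb : n ≤ (l.bd β).eval N := eval_le_bd h2 l h1 h3
  -- `F t` is the array after `t` rounds.
  set F : ℕ → ℕ → ℕ := fun t => (round (tabOf x) v n e (varsOf x))^[t] 0 with hF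
  set s : List RAMInstr := move (8 * (d + 1) + 4) (8 * v) ++ move (8 * (d + 2) + 4) (8 * d + 4)
    with hs
  set β' := Function.update β v (l.bd β) with hβ'
  let Inv : ℕ → (ℕ → ℕ) × List ℕ → Prop := fun k z => k ≤ n ∧ z.2 = inp ∧
    Frame false d (Function.update (setArr x (F (n - k))) (8 * v) (z.1 (8 * v))) z.1 ∧
    z.1 (8 * d + 4) = n ∧ z.1 (8 * (d + 1) + 4) = x (8 * v) ∧ z.1 (8 * (d + 2) + 4) = k
  have hstart : Inv n (after s y, inp) := by
    refine ⟨le_rfl, rfl, ?_, ?_, ?_, ?_⟩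
    · intro r h1 h2
      rcases eq_or_ne r (8 * v) with rfl | hne
      · rw [Function.update_self]
      · simp (disch := omega) only [hs, after_append, after_move, Function.update_of_ne, setArr]
        rw [hy r (by simp) h2]
        split_ifs with h4
        · have := congrFun hA0 (r / 4)
          simp only [hF, Nat.sub_self, Function.iterate_zero, id_eq]
          rw [← this, arrOf]
          congr 1
          omega
        · rfl
    · simp (disch := omega) only [hs, after_append, after_move, Function.update_of_ne, hv]
    · simp (disch := omega) only [hs, after_append, after_move, Function.update_of_ne,
        Function.update_self]
      exact hy _ (by omega) (by omega)
    · simp (disch := omega) only [hs, after_append, after_move, Function.update_of_ne,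
        Function.update_self, hv]
  obtain ⟨⟨z, inp'⟩, ⟨-, hzi, hzf, hz0, hz1, hz2⟩, hzr⟩ :=
    Cmd.runs_countdown (r := 8 * (d + 2) + 4) (u := 8 * (d + 3) + 4) (by omega)
    (c := (fillBuf v d (e.comp (d + 3))).seq (copyBuf d))
    (t := (2 + (n * ((e.tm β').eval N + 8 + 4) + 1)) + (2 + (n * (10 + 4) + 1))) Inv
    (fun j z hz => hz.2.2.2.2.2)
    (fun j z hz => by
      obtain ⟨hjn, hzi, hzf, hz0, hz1, hz2⟩ := hz
      set w := Function.update (Function.update z.1 (8 * (d + 3) + 4) 1) (8 * (d + 2) + 4) j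
        with hw
      have hwf : Frame false d (Function.update (setArr x (F (n - (j + 1)))) (8 * v)
          (z.1 (8 * v))) w := fun r h1 h2 => by
        rw [← hzf r h1 h2]
        simp (disch := omega) only [hw, Function.update_of_ne]
      have e1 : tabOf w = tabOf x := by rw [hwf.tabOf_eq, tabOf_update, tabOf_setArr]
      have e2 : varsOf w = Function.update (varsOf x) v (z.1 (8 * v)) := by
        rw [hwf.varsOf_eq, varsOf_update, varsOf_setArr]
      have e3 : arrOf w = F (n - (j + 1)) := by rw [hwf.arrOf_eq, arrOf_update, arrOf_setArr]
      obtain ⟨a, haf, hab, har⟩ := fillBuf_runs (v := v) (d := d) (n := n) (N := N) he β' w z.2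
        (by simp (disch := omega) only [hw, Function.update_of_ne, hz0])
        (by rw [e3]; exact iterate_round_le_one _ _ _ _ _ _) (by rwa [e1])
        (by
          intro j hj i
          rw [e2, Function.update_idem]
          exact update_le_eval h3 (by omega) v i)
      rw [e1, e2, e3, round_update] at hab
      have ha0 : a (8 * d + 4) = n := by
        rw [haf _ (by omega) (by omega)]
        simp (disch := omega) only [hw, Function.update_of_ne, hz0]
      obtain ⟨b, hbf, hbr⟩ := copyBuf_runs a z.2 ha0
      refine ⟨(b, z.2), ⟨by omega, hzi, ?_, ?_, ?_, ?_⟩, har.seq hbr⟩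
      · intro r h1 h2
        have h4 := h1 rfl
        rcases eq_or_ne r (8 * v) with rfl | hne
        · rw [Function.update_self]
        dsimp only
        rw [hbf r h1 (by omega), Function.update_of_ne hne, setArr, setArr]
        split_ifs with h5 h6
        · rw [hab _ h6]
          have : n - j = (n - (j + 1)) + 1 := by omega
          simp only [hF]
          rw [this, Function.iterate_succ_apply']
        · simp only [hF]
          rw [iterate_round_eq_zero _ _ _ _ _ _ (by omega), haf _ (by omega) (by omega),
            Function.update_of_ne (by omega)]
          have := congrFun e3 (r / 4)
          rw [arrOf] at this
          rw [this]
          simp only [hF]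
          rw [iterate_round_eq_zero _ _ _ _ _ _ (by omega)]
        · rw [haf r h1 (by omega), Function.update_of_ne hne, hwf r h1 h2,
            Function.update_of_ne hne, setArr, if_neg h5]
      · dsimp only
        rw [hbf _ (by omega) (by omega)]
        simp (disch := omega) only [setArr, if_neg, ha0]
      · dsimp only
        rw [hbf _ (by omega) (by omega)]
        simp (disch := omega) only [setArr, if_neg]
        rw [haf _ (by omega) (by omega)]
        simp (disch := omega) only [hw, Function.update_of_ne, hz1]
      · dsimp only
        rw [hbf _ (by omega) (by omega)]
        simp (disch := omega) only [setArr, if_neg]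
        rw [haf _ (by omega) (by omega)]
        simp (disch := omega) only [hw, Function.update_of_ne, Function.update_self])
    n (after s y, inp) hstart
  simp only at hzi hzf hz0 hz1 hz2
  subst hzi
  set w := after (move (8 * v) (8 * (d + 1) + 4)) z with hw
  have hwf : Frame false d (setArr x (F n)) w := by
    intro r h1 h2
    rcases eq_or_ne r (8 * v) with rfl | hne
    · simp (disch := omega) only [hw, after_move, Function.update_self, setArr, if_neg, hz1]
    · have := hzf r h1 h2
      simp (disch := omega) only [hw, after_move, Function.update_of_ne, Nat.sub_zero] at this ⊢
      exact this
  have e1 : tabOf w = tabOf x := by rw [hwf.tabOf_eq, tabOf_setArr]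
  have e2 : varsOf w = varsOf x := by rw [hwf.varsOf_eq, varsOf_setArr]
  have e3 : arrOf w = F n := by rw [hwf.arrOf_eq, arrOf_setArr]
  obtain ⟨a, haf, hav, har⟩ := hq (d + 2) N β w inp' (by simp)
    (by rw [e3]; exact iterate_round_le_one _ _ _ _ _ _) (by rwa [e1]) (by rwa [e2])
  rw [e1, e2, e3] at hav
  have ha0 : a (8 * d + 4) = n := by
    rw [haf _ (by simp) (by omega)]
    simp (disch := omega) only [hw, after_move, Function.update_of_ne, hz0]
  obtain ⟨b, hbf, hbr⟩ := clearArr_runs a inp' ha0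
  refine ⟨after (move (8 * d + 4) (8 * (d + 2) + 4)) b, ?_, ?_,
    ((((((hr.seq (runs_after rfl y inp')).seq hzr).seq (runs_after rfl z inp')).seq har).seq
      hbr).seq (runs_after rfl b inp')).mono ?_⟩
  · intro r h1 h2
    have h4 := h1 rfl
    simp (disch := omega) only [after_move, Function.update_of_ne]
    rw [hbf r h1 (by omega), setArr]
    split_ifs with h5 h6
    · have := congrFun hA0 (r / 4)
      rw [arrOf, Pi.zero_apply] at this
      rw [← this]
      congr 1
      omega
    · have := congrFun hA0 (r / 4)
      rw [haf _ (by simp) (by omega)]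
      have h7 := congrFun e3 (r / 4)
      rw [arrOf] at h7
      rw [h7]
      simp only [hF]
      rw [iterate_round_eq_zero _ _ _ _ _ _ (by omega), ← Pi.zero_apply (M := fun _ => ℕ) (r / 4),
        ← this, arrOf]
      congr 1
      omega
    · rw [haf r (by simp) (by omega), hwf r h1 h2, setArr, if_neg h5]
  · simp (disch := omega) only [after_move, Function.update_self]
    rw [hbf _ (by omega) (by omega)]
    simp (disch := omega) only [setArr, if_neg]
    rw [hav, eval_fix]
  · simp only [tm, Polynomial.eval_add, Polynomial.eval_mul, Polynomial.eval_one,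
      Polynomial.eval_ofNat, hs, move, List.length_append, List.length_cons, List.length_nil]
    gcongr <;> norm_num

/-- Compiled expressions are computed correctly and in polynomial time. -/
theorem compSpec {b : Bool} (e : Ex b) : CompSpec e := by
  induction e with
  | const c => exact compSpec_const c
  | var i => exact compSpec_var i
  | tab e he => exact compSpec_tab he
  | arr e he => exact compSpec_arr he
  | add e f he hf => exact compSpec_add he hf
  | sub e f he hf => exact compSpec_sub he hf
  | sum i e f he hf => exact compSpec_sum he hf
  | fix v l e q hl he hq => exact compSpec_fix hl he hq

end Ex

/-! ### Satisfiability of implications between literals -/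

open Relation in
/-- The solvability criterion for 2-SAT: if the set of implications `E` is closed under
contraposition and no literal is equivalent to its negation, then there is a consistent assignment
(given as the set of true literals) that respects all implications. A maximal consistent set that
is closed under implications decides every literal. -/
theorem exists_assignment {α : Type*} (neg : α → α) (hneg : ∀ a, neg (neg a) = a)
    (E : α → α → Prop) (hE : ∀ a b, E a b → E (neg b) (neg a))
    (h : ∀ a, ¬ (ReflTransGen E a (neg a) ∧ ReflTransGen E (neg a) a)) :
    ∃ S : Set α, (∀ a, neg a ∈ S ↔ a ∉ S) ∧ ∀ a b, E a b → a ∈ S → b ∈ S := by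
  have hE' : ∀ a b, ReflTransGen E a b → ReflTransGen E (neg b) (neg a) := by
    intro a b hab
    induction hab with
    | refl => exact .refl
    | tail _ h2 ih => exact .head (hE _ _ h2) ih
  let G : Set (Set α) := {S | (∀ a b, E a b → a ∈ S → b ∈ S) ∧ ∀ a ∈ S, neg a ∉ S}
  obtain ⟨S, hS⟩ := zorn_subset G (by
    intro c hc hchain
    refine ⟨⋃₀ c, ⟨?_, ?_⟩, fun s hs => Set.subset_sUnion_of_mem hs⟩
    · rintro a b hab ⟨s, hs, ha⟩
      exact ⟨s, hs, (hc hs).1 a b hab ha⟩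
    · rintro a ⟨s, hs, ha⟩ ⟨s', hs', ha'⟩
      rcases hchain.total hs hs' with hss | hss
      · exact (hc hs').2 a (hss ha) ha'
      · exact (hc hs).2 a ha (hss ha'))
  obtain ⟨hS1, hS2⟩ := hS.prop
  have hS1' : ∀ a b, ReflTransGen E a b → a ∈ S → b ∈ S := by
    intro a b hab ha
    induction hab with
    | refl => exact ha
    | tail _ h2 ih => exact hS1 _ _ h2 ih
  -- If `a` does not imply `neg a`, then `a` or `neg a` is in `S`, by maximality.
  have key : ∀ a, ¬ ReflTransGen E a (neg a) → a ∈ S ∨ neg a ∈ S := by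
    intro a ha
    by_contra! hcon
    have hmem : S ∪ {b | ReflTransGen E a b} ∈ G := by
      refine ⟨?_, ?_⟩
      · rintro b c hbc (hb | hb)
        · exact Or.inl (hS1 b c hbc hb)
        · exact Or.inr (ReflTransGen.tail hb hbc)
      · rintro b (hb | hb) (hb' | hb')
        · exact hS2 b hb hb'
        · have := hE' _ _ hb'
          rw [hneg] at this
          exact hcon.2 (hS1' _ _ this hb)
        · exact hcon.2 (hS1' _ _ (hE' _ _ hb) hb')
        · have := hE' _ _ hb'
          rw [hneg] at this
          exact ha (ReflTransGen.trans hb this)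
    exact hcon.1 (hS.le_of_ge hmem Set.subset_union_left (Or.inr .refl))
  refine ⟨S, fun a => ⟨fun h1 h2 => hS2 a h2 h1, fun h1 => ?_⟩, hS1⟩
  by_cases ha : ReflTransGen E a (neg a)
  · have := key (neg a) (by rw [hneg]; exact fun h2 => h a ⟨ha, h2⟩)
    rw [hneg] at this
    exact this.resolve_right h1
  · exact (key a ha).resolve_left h1

open Relation in
/-- Iterated closure of an array of bits under a relation `R` on `{0, …, n - 1}`, beginning with
`a`, computes the set of all elements that can be reached from `a` within `n` rounds: every round
that changes the array increases the number of bits that are `1`. -/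
theorem iterate_closure {n : ℕ} {R : ℕ → ℕ → Prop} {a : ℕ} (ha : a < n)
    (hR : ∀ i j, R i j → j < n) {F : (ℕ → ℕ) → ℕ → ℕ} (hF1 : ∀ A j, F A j ≤ 1)
    (hF : ∀ A j, F A j ≠ 0 ↔ j < n ∧ (j = a ∨ A j ≠ 0 ∨ ∃ i, A i ≠ 0 ∧ R i j)) (j : ℕ) :
    F^[n] 0 j ≠ 0 ↔ ReflTransGen R a j := by
  have hsound : ∀ t j, F^[t] 0 j ≠ 0 → j < n ∧ ReflTransGen R a j := by
    intro t
    induction t with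
    | zero => intro j hj; simp at hj
    | succ t ih =>
      intro j hj
      rw [Function.iterate_succ_apply', hF] at hj
      refine ⟨hj.1, ?_⟩
      rcases hj.2 with rfl | h | ⟨i, hi, hij⟩
      · exact .refl
      · exact (ih _ h).2
      · exact .tail (ih _ hi).2 hij
  have hle1 : ∀ t j, F^[t] 0 j ≤ 1 := by
    intro t j
    cases t with
    | zero => simp
    | succ t => rw [Function.iterate_succ_apply']; exact hF1 _ _
  have hgrow : ∀ t, F^[t + 1] 0 ≠ F^[t] 0 →
      ∑ j ∈ Finset.range n, F^[t] 0 j < ∑ j ∈ Finset.range n, F^[t + 1] 0 j := by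
    intro t ht
    have hle : ∀ j, F^[t] 0 j ≤ F^[t + 1] 0 j := by
      intro j
      by_cases h0 : F^[t] 0 j = 0
      · omega
      · have h1 : F^[t + 1] 0 j ≠ 0 := by
          rw [Function.iterate_succ_apply', hF]
          exact ⟨(hsound t j h0).1, Or.inr (Or.inl h0)⟩
        have := hle1 t j
        omega
    obtain ⟨j, hj⟩ := Function.ne_iff.1 ht
    have hj' := lt_of_le_of_ne (hle j) (Ne.symm hj)
    refine Finset.sum_lt_sum (fun j _ => hle j) ⟨j, ?_, hj'⟩
    exact Finset.mem_range.2 (hsound (t + 1) j (by omega)).1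
  have hstable : ∀ t, F^[t + 1] 0 = F^[t] 0 ∨
      t + 1 ≤ ∑ j ∈ Finset.range n, F^[t + 1] 0 j := by
    intro t
    induction t with
    | zero =>
      by_cases h : F^[0 + 1] 0 = F^[0] 0
      · exact Or.inl h
      · have := hgrow 0 h
        right
        omega
    | succ t ih =>
      by_cases h : F^[t + 1 + 1] 0 = F^[t + 1] 0
      · exact Or.inl h
      · have := hgrow (t + 1) h
        rcases ih with ih | ih
        · refine absurd ?_ h
          rw [Function.iterate_succ_apply', ih, ← Function.iterate_succ_apply' F, ih]
        · right
          omega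
  have hfix : F (F^[n] 0) = F^[n] 0 := by
    rw [← Function.iterate_succ_apply' F]
    refine (hstable n).resolve_right fun h => ?_
    have : ∑ j ∈ Finset.range n, F^[n + 1] 0 j ≤ ∑ j ∈ Finset.range n, 1 :=
      Finset.sum_le_sum fun j _ => hle1 _ _
    simp only [Finset.sum_const, Finset.card_range, smul_eq_mul, mul_one] at this
    omega
  refine ⟨fun h => (hsound n j h).2, fun h => ?_⟩
  induction h with
  | refl =>
    rw [← hfix, hF]
    exact ⟨ha, Or.inl rfl⟩
  | tail _ hbc ih =>
    rw [← hfix, hF]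
    exact ⟨hR _ _ hbc, Or.inr (Or.inr ⟨_, ih, hbc⟩)⟩

/-! ### Embeddings as solutions of a system of implications -/

/-- Literals. For `u < m` the literal `(u, s, true)` says that the point at position `u` of the
pattern is sent to a point with position at least `s`; for `u = m + p` it says that the point at
position `p` is sent to a point with value at least `s` (positions and values are counted from `0`
here). `(u, s, false)` is the negation of `(u, s, true)`. -/
abbrev Lit := ℕ × ℕ × Bool

namespace Lit

/-- The negation of a literal. -/
def neg (a : Lit) : Lit := (a.1, a.2.1, !a.2.2)

theorem neg_neg (a : Lit) : a.neg.neg = a := by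
  simp [neg]

/-- The literals in use for a pattern of length `m` and a text of length `n`. -/
def InRange (m n : ℕ) (a : Lit) : Prop := a.1 < m + m ∧ a.2.1 < n + 1

end Lit

/-- Coordinate `u` of the pattern `p` has to be smaller than coordinate `v` of the same kind. -/
def CoordLT (m : ℕ) (p : ℕ → ℕ) (u v : ℕ) : Prop :=
  (u < v ∧ v < m) ∨ (m ≤ u ∧ m ≤ v ∧ p (u - m) < p (v - m))

/-- The implications that describe an embedding of a pattern of length `m` with values
`p 0, p 1, …` into a text of length `n` with values `t 0, t 1, …` (all values are counted from
`1`). `A i x` says that point `i` of the pattern may be sent to point `x` of the text, and that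
text values increase where this is possible; `D i x` is the same for decreasing values. Apart
from the implications that make thresholds consistent and keep the order of coordinates, there
are those that link the position of an image to its value: in an increasing cell, position `≥ x`
implies value `≥ t x - 1` and position `≤ x` implies value `≤ t x - 1`. -/
def Implies (m n : ℕ) (p t : ℕ → ℕ) (A D : ℕ → ℕ → Prop) : Lit → Lit → Prop
  | (u, s, true), (v, r, true) =>
    (u = v ∧ s = r + 1) ∨ (CoordLT m p u v ∧ r = s + 1) ∨
    (u < m ∧ v = u + m ∧ s < n ∧ A u s ∧ r + 1 = t s) ∨
    (u < m ∧ u = v ∧ r = s + 1 ∧ ¬ A u s ∧ ¬ D u s)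
  | (u, s, false), (v, r, true) =>
    (u = v ∧ s = 0 ∧ r = 0) ∨
    (u < m ∧ v = u + m ∧ 0 < s ∧ D u (s - 1) ∧ r + 1 = t (s - 1))
  | (u, s, true), (v, r, false) =>
    (u = v ∧ s = n ∧ r = n) ∨ (u < m ∧ v = u + m ∧ s < n ∧ D u s ∧ r = t s)
  | (u, s, false), (v, r, false) =>
    u < m ∧ v = u + m ∧ 0 < s ∧ A u (s - 1) ∧ r = t (s - 1)

/-- `S` is a consistent assignment that respects all implications. -/
def Solves (m n : ℕ) (I : Lit → Lit → Prop) (S : Set Lit) : Prop :=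
  (∀ a : Lit, a.neg ∈ S ↔ a ∉ S) ∧
    ∀ a b : Lit, a.InRange m n → b.InRange m n → I a b → a ∈ S → b ∈ S

/-- `f` embeds the pattern with values `p` into the text with values `t`. -/
def Embeds (m n : ℕ) (p t f : ℕ → ℕ) : Prop :=
  (∀ i < m, f i < n) ∧ (∀ i j, i < j → j < m → f i < f j) ∧
    ∀ i < m, ∀ j < m, p i < p j → t (f i) < t (f j)

/-- Every solution gives an embedding, whatever `A` and `D` are. -/
theorem Solves.exists_embeds {m n : ℕ} {p t : ℕ → ℕ} {A D : ℕ → ℕ → Prop} {S : Set Lit}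
    (hS : Solves m n (Implies m n p t A D) S) (ht : ∀ x < n, 1 ≤ t x ∧ t x ≤ n) :
    ∃ f, Embeds m n p t f := by
  obtain ⟨hneg, himp⟩ := hS
  have hneg' : ∀ u s, (u, s, false) ∈ S ↔ (u, s, true) ∉ S := fun u s => hneg (u, s, true)
  -- The thresholds that hold for coordinate `u` are those up to some `z < n`.
  have hZ : ∀ u, ∃ z, u < m + m → z < n ∧ ∀ s ≤ n, (u, s, true) ∈ S ↔ s ≤ z := by
    classical
    intro u
    refine ⟨Nat.findGreatest (fun s => (u, s, true) ∈ S) n, fun hu => ?_⟩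
    set z := Nat.findGreatest (fun s => (u, s, true) ∈ S) n with hz
    have h0 : (u, 0, true) ∈ S := by
      by_contra h
      exact h (himp (u, 0, false) (u, 0, true) ⟨hu, by simp⟩ ⟨hu, by simp⟩
        (Or.inl ⟨rfl, rfl, rfl⟩) ((hneg' _ _).2 h))
    have hn : (u, n, true) ∉ S := by
      intro h
      exact (hneg' _ _).1 (himp (u, n, true) (u, n, false) ⟨hu, by simp⟩ ⟨hu, by simp⟩
        (Or.inl ⟨rfl, rfl, rfl⟩) h) h
    have hzS : (u, z, true) ∈ S :=
      Nat.findGreatest_spec (P := fun s => (u, s, true) ∈ S) (Nat.zero_le n) h0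
    have hzn : z ≤ n := Nat.findGreatest_le n
    refine ⟨lt_of_le_of_ne hzn fun h => hn (h ▸ hzS), fun s hs => ⟨fun h => ?_, fun h => ?_⟩⟩
    · exact Nat.le_findGreatest hs h
    · induction h using Nat.decreasingInduction with
      | self => exact hzS
      | of_succ k hk ih =>
        exact himp (u, k + 1, true) (u, k, true) ⟨hu, by simp; omega⟩ ⟨hu, by simp; omega⟩
          (Or.inl ⟨rfl, rfl⟩) (ih (by omega))
  choose Z hZ using hZ
  have hlt : ∀ u < m + m, ∀ v < m + m, CoordLT m p u v → Z u < Z v := by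
    intro u hu v hv huv
    have hzu := (hZ u hu).1
    have h := himp (u, Z u, true) (v, Z u + 1, true) ⟨hu, by simp; omega⟩ ⟨hv, by simp; omega⟩
      (Or.inr (Or.inl ⟨huv, rfl⟩)) (((hZ u hu).2 _ hzu.le).2 le_rfl)
    exact ((hZ v hv).2 _ (by omega)).1 h
  have hlink : ∀ i < m, t (Z i) = Z (i + m) + 1 := by
    intro i hi
    obtain ⟨hz, hzS⟩ := hZ i (by omega)
    obtain ⟨hy, hyS⟩ := hZ (i + m) (by omega)
    obtain ⟨ht1, htn⟩ := ht _ hz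
    have hin : (i, Z i, true) ∈ S := (hzS _ hz.le).2 le_rfl
    have hout : (i, Z i + 1, true) ∉ S := fun h => by
      have := (hzS _ hz).1 h
      omega
    have hin' := (hneg' _ _).2 hout
    by_cases hA : A i (Z i)
    · have h1 := himp (i, Z i, true) (i + m, t (Z i) - 1, true) ⟨by simp; omega, by simp; omega⟩
        ⟨by simp; omega, by simp; omega⟩
        (Or.inr (Or.inr (Or.inl ⟨hi, rfl, hz, hA, by omega⟩))) hin
      have h2 := himp (i, Z i + 1, false) (i + m, t (Z i), false) ⟨by simp; omega, by simp; omega⟩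
        ⟨by simp; omega, by simp; omega⟩ ⟨hi, rfl, by omega, by simpa using hA, by simp⟩ hin'
      rw [hneg', hyS _ htn] at h2
      rw [hyS _ (by omega)] at h1
      omega
    · by_cases hD : D i (Z i)
      · have h1 := himp (i, Z i, true) (i + m, t (Z i), false) ⟨by simp; omega, by simp; omega⟩
          ⟨by simp; omega, by simp; omega⟩ (Or.inr ⟨hi, rfl, hz, hD, rfl⟩) hin
        have h2 := himp (i, Z i + 1, false) (i + m, t (Z i) - 1, true)
          ⟨by simp; omega, by simp; omega⟩ ⟨by simp; omega, by simp; omega⟩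
          (Or.inr ⟨hi, rfl, by omega, by simpa using hD, by simp; omega⟩) hin'
        rw [hneg', hyS _ htn] at h1
        rw [hyS _ (by omega)] at h2
        omega
      · exact absurd (himp (i, Z i, true) (i, Z i + 1, true) ⟨by simp; omega, by simp; omega⟩
          ⟨by simp; omega, by simp; omega⟩ (Or.inr (Or.inr (Or.inr ⟨hi, rfl, rfl, hA, hD⟩))) hin)
          hout
  refine ⟨Z, fun i hi => (hZ i (by omega)).1, fun i j hij hj => ?_, fun i hi j hj hp => ?_⟩
  · exact hlt i (by omega) j (by omega) (Or.inl ⟨hij, hj⟩)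
  · rw [hlink i hi, hlink j hj]
    have := hlt (i + m) (by omega) (j + m) (by omega)
      (Or.inr ⟨by omega, by omega, by simpa using hp⟩)
    omega

/-- An embedding that respects the cells gives a solution. -/
theorem Embeds.exists_solves {m n : ℕ} {p t f : ℕ → ℕ} {A D : ℕ → ℕ → Prop}
    (hf : Embeds m n p t f) (ht : ∀ x < n, 1 ≤ t x ∧ t x ≤ n)
    (hAD : ∀ i < m, A i (f i) ∨ D i (f i))
    (hA : ∀ i < m, ∀ x < n, A i x → (x ≤ f i → t x ≤ t (f i)) ∧ (f i ≤ x → t (f i) ≤ t x))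
    (hD : ∀ i < m, ∀ x < n, D i x → (x ≤ f i → t (f i) ≤ t x) ∧ (f i ≤ x → t x ≤ t (f i))) :
    ∃ S, Solves m n (Implies m n p t A D) S := by
  obtain ⟨hfn, hfm, hft⟩ := hf
  set Z : ℕ → ℕ := fun u => if u < m then f u else t (f (u - m)) - 1 with hZ
  have hZ1 : ∀ u, u < m → Z u = f u := fun u hu => if_pos hu
  have hZ2 : ∀ u, m ≤ u → u < m + m → Z u + 1 = t (f (u - m)) := fun u hu hu' => by
    rw [hZ]
    dsimp only
    rw [if_neg (by omega)]
    have := ht _ (hfn (u - m) (by omega))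
    omega
  have hZn : ∀ u, u < m + m → Z u < n := fun u hu => by
    by_cases h : u < m
    · rw [hZ1 u h]
      exact hfn u h
    · have h1 := hZ2 u (by omega) hu
      have := ht _ (hfn (u - m) (by omega))
      omega
  refine ⟨{a | a.2.2 = true ↔ a.2.1 ≤ Z a.1}, ?_, ?_⟩
  · rintro ⟨u, s, σ⟩
    cases σ <;> simp [Lit.neg]
  · rintro ⟨u, s, σ⟩ ⟨v, r, ρ⟩ ⟨hu, hs⟩ ⟨hv, hr⟩ h ha
    simp only at hu hs hv hr
    cases σ <;> cases ρ <;>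
      simp only [Set.mem_ofPred_eq, true_iff, false_iff, Bool.false_eq_true] at ha ⊢ <;>
      simp only [Implies] at h
    · obtain ⟨h1, rfl, h2, h3, rfl⟩ := h
      rw [hZ1 u h1] at ha
      have h4 := hZ2 (u + m) (by omega) hv
      rw [Nat.add_sub_cancel] at h4
      have := (hA u h1 _ (by omega) h3).2 (by omega)
      omega
    · rcases h with ⟨rfl, rfl, rfl⟩ | ⟨h1, rfl, h2, h3, h5⟩
      · omega
      · rw [hZ1 u h1] at ha
        have h4 := hZ2 (u + m) (by omega) hv
        rw [Nat.add_sub_cancel] at h4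
        have := (hD u h1 _ (by omega) h3).2 (by omega)
        omega
    · rcases h with ⟨rfl, rfl, rfl⟩ | ⟨h1, rfl, h2, h3, rfl⟩
      · have := hZn u hu
        omega
      · rw [hZ1 u h1] at ha
        have h4 := hZ2 (u + m) (by omega) hv
        rw [Nat.add_sub_cancel] at h4
        have := (hD u h1 _ (by omega) h3).1 (by omega)
        omega
    · rcases h with ⟨rfl, rfl⟩ | ⟨h1, rfl⟩ | ⟨h1, rfl, h2, h3, h5⟩ | ⟨h1, rfl, rfl, h3, h5⟩
      · omega
      · rcases h1 with ⟨h1, h2⟩ | ⟨h1, h2, h3⟩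
        · have := hfm u v h1 h2
          rw [hZ1 u (by omega)] at ha
          rw [hZ1 v h2]
          omega
        · have h4 := hft _ (by omega) _ (by omega) h3
          have h5 := hZ2 u h1 hu
          have h6 := hZ2 v h2 hv
          omega
      · rw [hZ1 u h1] at ha
        have h4 := hZ2 (u + m) (by omega) hv
        rw [Nat.add_sub_cancel] at h4
        have := (hA u h1 _ (by omega) h3).1 (by omega)
        omega
      · rw [hZ1 u h1] at ha ⊢
        have h6 : s ≠ f u := by
          rintro rfl
          exact (hAD u h1).elim h3 h5
        omega

open Relation in
/-- Solvability in terms of reachability. -/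
theorem exists_solves_iff (m n : ℕ) (I : Lit → Lit → Prop) :
    (∃ S, Solves m n I S) ↔ ∀ u < m + m, ∀ s < n + 1,
      ¬ (ReflTransGen (fun a b : Lit => a.InRange m n ∧ b.InRange m n ∧ (I a b ∨ I b.neg a.neg))
          (u, s, true) (u, s, false) ∧
        ReflTransGen (fun a b : Lit => a.InRange m n ∧ b.InRange m n ∧ (I a b ∨ I b.neg a.neg))
          (u, s, false) (u, s, true)) := by
  set E : Lit → Lit → Prop :=
    fun a b => a.InRange m n ∧ b.InRange m n ∧ (I a b ∨ I b.neg a.neg) with hE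
  constructor
  · rintro ⟨S, hS1, hS2⟩ u hu s hs ⟨h1, h2⟩
    have hES : ∀ a b : Lit, E a b → a ∈ S → b ∈ S := by
      rintro a b ⟨ha, hb, h | h⟩ haS
      · exact hS2 a b ha hb h haS
      · by_contra hbS
        exact (hS1 a).1 (hS2 b.neg a.neg hb ha h ((hS1 b).2 hbS)) haS
    have hES' : ∀ a b : Lit, ReflTransGen E a b → a ∈ S → b ∈ S := by
      intro a b hab haS
      induction hab with
      | refl => exact haS
      | tail _ h ih => exact hES _ _ h ih
    have h3 := hS1 (u, s, true)
    have h4 := hES' _ _ h1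
    have h5 := hES' _ _ h2
    simp only [Lit.neg, Bool.not_true] at h3
    tauto
  · intro h
    obtain ⟨S, hS1, hS2⟩ := exists_assignment Lit.neg Lit.neg_neg E
      (by
        rintro a b ⟨ha, hb, h⟩
        refine ⟨hb, ha, ?_⟩
        rw [Lit.neg_neg, Lit.neg_neg]
        exact h.symm)
      (by
        rintro ⟨u, s, σ⟩ ⟨h1, h2⟩
        -- A literal from which an implication starts is in range.
        have hr : Lit.InRange m n (u, s, σ) := by
          rcases ReflTransGen.cases_head h1 with h3 | ⟨c, h3, -⟩
          · simp [Lit.neg] at h3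
          · exact h3.1
        cases σ
        · exact h u hr.1 s hr.2 ⟨h2, h1⟩
        · exact h u hr.1 s hr.2 ⟨h1, h2⟩)
    exact ⟨S, hS1, fun a b ha hb hab => hS2 a b ⟨ha, hb, Or.inl hab⟩⟩

/-! ### Formulas as expressions -/

namespace Ex

variable {b : Bool}

/-- An expression used as a formula is true if its value is not `0`. -/
def Holds (T : ℕ → ℕ) (e : Ex b) (x A : ℕ → ℕ) : Prop := e.eval T x A ≠ 0

/-- Negation. -/
def not (e : Ex b) : Ex b := sub (const 1) e

/-- Conjunction. -/
def and (e f : Ex b) : Ex b := not (add (not e) (not f))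

/-- Disjunction. -/
def or (e f : Ex b) : Ex b := add e f

/-- The comparison `e < f`. -/
def lt (e f : Ex b) : Ex b := sub f e

/-- The comparison `e ≤ f`. -/
def le (e f : Ex b) : Ex b := not (sub e f)

/-- The comparison `e = f`. -/
def eq (e f : Ex b) : Ex b := and (le e f) (le f e)

/-- The existential quantifier for variable `i` below `e`. -/
def ex (i : ℕ) (e f : Ex b) : Ex b := sum i e f

/-- The universal quantifier for variable `i` below `e`. -/
def all (i : ℕ) (e f : Ex b) : Ex b := not (sum i e (not f))

/-- The disjunction of a list of formulas. -/
def any (l : List (Ex b)) : Ex b := l.foldr or (const 0)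

variable (T x A : ℕ → ℕ)

theorem holds_not (e : Ex b) : (not e).Holds T x A ↔ ¬ e.Holds T x A := by
  simp only [Holds, not, eval]
  omega

theorem holds_and (e f : Ex b) : (and e f).Holds T x A ↔ e.Holds T x A ∧ f.Holds T x A := by
  simp only [Holds, and, not, eval]
  omega

theorem holds_or (e f : Ex b) : (or e f).Holds T x A ↔ e.Holds T x A ∨ f.Holds T x A := by
  simp only [Holds, or, eval]
  omega

theorem holds_lt (e f : Ex b) : (lt e f).Holds T x A ↔ e.eval T x A < f.eval T x A := by
  simp only [Holds, lt, eval]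
  omega

theorem holds_le (e f : Ex b) : (le e f).Holds T x A ↔ e.eval T x A ≤ f.eval T x A := by
  simp only [Holds, le, not, eval]
  omega

theorem holds_eq (e f : Ex b) : (eq e f).Holds T x A ↔ e.eval T x A = f.eval T x A := by
  rw [eq, holds_and, holds_le, holds_le]
  omega

theorem holds_ex (i : ℕ) (e f : Ex b) : (ex i e f).Holds T x A ↔
    ∃ j < e.eval T x A, f.Holds T (Function.update x i j) A := by
  simp [Holds, ex, eval]

theorem holds_all (i : ℕ) (e f : Ex b) : (all i e f).Holds T x A ↔
    ∀ j < e.eval T x A, f.Holds T (Function.update x i j) A := by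
  rw [all, holds_not, ← ex, holds_ex]
  simp [holds_not]

theorem holds_any (l : List (Ex b)) : (any l).Holds T x A ↔ ∃ e ∈ l, e.Holds T x A := by
  induction l with
  | nil => simp [any, Holds, eval]
  | cons e l ih =>
    rw [any, List.foldr_cons, ← any, holds_or, ih]
    simp

theorem holds_arr (e : Ex true) : (arr e).Holds T x A ↔ A (e.eval T x A) ≠ 0 := Iff.rfl

/-- Existential quantifiers for the variables `10, …, 9 + k` below `e`. -/
def exMany (e : Ex b) : ℕ → Ex b → Ex b
  | 0, f => f
  | k + 1, f => exMany e k (ex (10 + k) e f)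

theorem holds_exMany {e : Ex b} {n : ℕ} (he : ∀ x, e.eval T x A = n) (k : ℕ) :
    ∀ (f : Ex b), (exMany e k f).Holds T x A ↔ ∃ y : ℕ → ℕ, (∀ i < k, y (10 + i) < n) ∧
      (∀ i, (∀ j < k, i ≠ 10 + j) → y i = x i) ∧ f.Holds T y A := by
  induction k with
  | zero =>
    intro f
    constructor
    · intro h
      exact ⟨x, by simp, by simp, h⟩
    · rintro ⟨y, -, hy, h⟩
      obtain rfl : y = x := funext fun i => hy i (by simp)
      exact h
  | succ k ih =>
    intro f
    rw [exMany, ih]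
    simp only [holds_ex, he]
    constructor
    · rintro ⟨y, h1, h2, j, hj, h3⟩
      refine ⟨Function.update y (10 + k) j, fun i hi => ?_, fun i hi => ?_, h3⟩
      · rcases eq_or_ne i k with rfl | hne
        · simpa using hj
        · rw [Function.update_of_ne (by omega)]
          exact h1 i (by omega)
      · rw [Function.update_of_ne (hi k (by omega))]
        exact h2 i fun j hj => hi j (by omega)
    · rintro ⟨y, h1, h2, h3⟩
      refine ⟨Function.update y (10 + k) (x (10 + k)), fun i hi => ?_, fun i hi => ?_,
        y (10 + k), h1 k (by omega), ?_⟩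
      · rw [Function.update_of_ne (by omega)]
        exact h1 i (by omega)
      · rcases eq_or_ne i (10 + k) with rfl | hne
        · simp
        · rw [Function.update_of_ne hne]
          refine h2 i fun j hj => ?_
          rcases eq_or_ne j k with rfl | hjk
          · exact hne
          · exact hi j (by omega)
      · rwa [Function.update_idem, Function.update_eq_self]

/-! ### The decision procedure as an expression

The input table holds the codes of the pattern and of the text one after the other. Variable `0` is
used in products, variables `1` and `2` for a coordinate and a threshold to be checked for
consistency, variable `3` for the index in the array of reachable literals, variables `4`, `5` and
`6`, `7` for coordinates and thresholds of two literals, and the variables from `10` on for the cut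
points of the griddings of text and pattern. -/

/-- The length of the pattern. -/
def patLen : Ex b := tab (const 0)

/-- The value of the pattern at position `e`. -/
def patAt (e : Ex b) : Ex b := tab (add (const 1) e)

/-- The length of the text. -/
def textLen : Ex b := tab (add (const 1) patLen)

/-- The value of the text at position `e`. -/
def textAt (e : Ex b) : Ex b := tab (add (add (const 2) patLen) e)

/-- The number of thresholds for every coordinate. -/
def thresholds : Ex b := add textLen (const 1)

/-- The index of a literal in the array. -/
def index (u s : Ex b) (σ : Bool) : Ex b :=
  add (sum 0 (add (add u u) (const σ.toNat)) thresholds) s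

/-- The number of literals. -/
def litCount : Ex b :=
  sum 0 (add (add patLen patLen) (add patLen patLen)) thresholds

/-- Point `p` of the pattern and point `q` of the text are both in cell `ij`, according to the cut
points given by the variables: `10 + 4 * i` and `11 + 4 * i` hold column `i` of the text and of the
pattern, `12 + 4 * j` and `13 + 4 * j` row `j` of the text and of the pattern. -/
def bothIn (p q : Ex b) (ij : ℕ × ℕ) : Ex b :=
  and (and (and (le (var (10 + 4 * ij.1)) q) (lt q (var (10 + 4 * (ij.1 + 1)))))
    (and (le (var (11 + 4 * ij.1)) p) (lt p (var (11 + 4 * (ij.1 + 1))))))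
  (and (and (lt (var (12 + 4 * ij.2)) (textAt q)) (le (textAt q) (var (12 + 4 * (ij.2 + 1)))))
    (and (lt (var (13 + 4 * ij.2)) (patAt p)) (le (patAt p) (var (13 + 4 * (ij.2 + 1))))))

/-- Point `p` of the pattern and point `q` of the text are in the same cell, one from the list. -/
def together (l : List (ℕ × ℕ)) (p q : Ex b) : Ex b := any (l.map (bothIn p q))

/-- The relation `CoordLT`. -/
def coordLT (u v : Ex b) : Ex b :=
  or (and (lt u v) (lt v patLen))
    (and (and (le patLen u) (le patLen v)) (lt (patAt (sub u patLen)) (patAt (sub v patLen))))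

/-- The relation `Implies`, for the cells `lA` with increasing and `lD` with decreasing
content. -/
def implies (lA lD : List (ℕ × ℕ)) (u s v r : Ex b) : Bool → Bool → Ex b
  | true, true =>
    or (or (and (eq u v) (eq s (add r (const 1)))) (and (coordLT u v) (eq r (add s (const 1)))))
    (or (and (and (and (lt u patLen) (eq v (add u patLen))) (and (lt s textLen)
        (together lA u s))) (eq (add r (const 1)) (textAt s)))
      (and (and (and (lt u patLen) (eq u v)) (eq r (add s (const 1))))
        (and (not (together lA u s)) (not (together lD u s)))))
  | false, true =>
    or (and (eq u v) (and (eq s (const 0)) (eq r (const 0))))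
      (and (and (lt u patLen) (eq v (add u patLen))) (and (and (lt (const 0) s)
        (together lD u (sub s (const 1)))) (eq (add r (const 1)) (textAt (sub s (const 1))))))
  | true, false =>
    or (and (eq u v) (and (eq s textLen) (eq r textLen)))
      (and (and (lt u patLen) (eq v (add u patLen))) (and (and (lt s textLen)
        (together lD u s)) (eq r (textAt s))))
  | false, false =>
      and (and (lt u patLen) (eq v (add u patLen))) (and (and (lt (const 0) s)
        (together lA u (sub s (const 1)))) (eq r (textAt (sub s (const 1)))))

/-- The literal whose index is the value of variable `3` is reached from the literals in the array
in one step, by the implication between the literals of signs `σ` and `ρ` given by the variables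
`4` to `7`, or by its contraposition. -/
def reachedBy (lA lD : List (ℕ × ℕ)) (σ ρ : Bool) : Ex true :=
  and (implies lA lD (var 4) (var 5) (var 6) (var 7) σ ρ)
    (or (and (arr (index (var 4) (var 5) σ)) (eq (var 3) (index (var 6) (var 7) ρ)))
      (and (arr (index (var 6) (var 7) !ρ)) (eq (var 3) (index (var 4) (var 5) !σ))))

/-- The literal with the index given by variable `3` belongs to the next array in the closure under
implications that starts with the literal with index `src`. -/
def nextReach (lA lD : List (ℕ × ℕ)) (src : Ex true) : Ex true :=
  or (or (eq (var 3) src) (arr (var 3)))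
    (ex 4 (add patLen patLen) (ex 5 thresholds (ex 6 (add patLen patLen) (ex 7 thresholds
      (or (or (reachedBy lA lD true true) (reachedBy lA lD true false))
        (or (reachedBy lA lD false true) (reachedBy lA lD false false)))))))

/-- The literal of sign `!σ` is reachable from the literal of sign `σ`, for the coordinate and the
threshold given by the variables `1` and `2`. -/
def flips (lA lD : List (ℕ × ℕ)) (σ : Bool) : Ex false :=
  fix 3 litCount (nextReach lA lD (index (var 1) (var 2) σ))
    (arr (index (var 1) (var 2) !σ))

/-- The whole decision procedure, with `k` variables for cut points. -/
def decision (lA lD : List (ℕ × ℕ)) (k : ℕ) : Ex false :=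
  not (not (exMany (add (add patLen textLen) (const 1)) k
    (all 1 (add patLen patLen) (all 2 thresholds
      (not (and (flips lA lD true) (flips lA lD false)))))))

variable {T} {m n : ℕ} {p t : ℕ → ℕ}

/-- The input table `T` describes a pattern of length `m` with values `p` and a text of length `n`
with values `t`. -/
structure Describes (T : ℕ → ℕ) (m n : ℕ) (p t : ℕ → ℕ) : Prop where
  patLen_eq : T 0 = m
  patAt_eq : ∀ i, T (1 + i) = p i
  textLen_eq : T (1 + m) = n
  textAt_eq : ∀ i, T (2 + m + i) = t i

theorem eval_patLen (h : Describes T m n p t) : (patLen : Ex b).eval T x A = m := h.patLen_eq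

theorem eval_patAt (h : Describes T m n p t) (e : Ex b) :
    (patAt e).eval T x A = p (e.eval T x A) := h.patAt_eq _

theorem eval_textLen (h : Describes T m n p t) : (textLen : Ex b).eval T x A = n := by
  rw [textLen, eval, eval, eval_patLen x A h, eval, h.textLen_eq]

theorem eval_textAt (h : Describes T m n p t) (e : Ex b) :
    (textAt e).eval T x A = t (e.eval T x A) := by
  rw [textAt, eval, eval, eval, eval_patLen x A h, eval, h.textAt_eq]

theorem eval_thresholds (h : Describes T m n p t) : (thresholds : Ex b).eval T x A = n + 1 := by
  rw [thresholds, eval, eval_textLen x A h, eval]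

/-- The semantics of `bothIn`. -/
def BothIn (p t x : ℕ → ℕ) (i q : ℕ) (c : ℕ × ℕ) : Prop :=
  ((x (10 + 4 * c.1) ≤ q ∧ q < x (10 + 4 * (c.1 + 1))) ∧
    (x (11 + 4 * c.1) ≤ i ∧ i < x (11 + 4 * (c.1 + 1)))) ∧
  ((x (12 + 4 * c.2) < t q ∧ t q ≤ x (12 + 4 * (c.2 + 1))) ∧
    (x (13 + 4 * c.2) < p i ∧ p i ≤ x (13 + 4 * (c.2 + 1))))

/-- The semantics of `together`. -/
def Together (p t x : ℕ → ℕ) (l : List (ℕ × ℕ)) (i q : ℕ) : Prop :=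
  ∃ c ∈ l, BothIn p t x i q c

theorem holds_together (h : Describes T m n p t) (l : List (ℕ × ℕ)) (i q : Ex b) :
    (together l i q).Holds T x A ↔ Together p t x l (i.eval T x A) (q.eval T x A) := by
  simp only [together, holds_any, List.mem_map, exists_exists_and_eq_and, bothIn, holds_and,
    holds_le, holds_lt, eval_textAt x A h, eval_patAt x A h, eval, Together, BothIn]

theorem holds_coordLT (h : Describes T m n p t) (u v : Ex b) :
    (coordLT u v).Holds T x A ↔ CoordLT m p (u.eval T x A) (v.eval T x A) := by
  simp only [coordLT, CoordLT, holds_or, holds_and, holds_le, holds_lt, eval_patAt x A h, eval,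
    eval_patLen x A h, and_assoc]

theorem holds_implies (h : Describes T m n p t) (lA lD : List (ℕ × ℕ)) (u s v r : Ex b)
    (σ ρ : Bool) : (implies lA lD u s v r σ ρ).Holds T x A ↔
      Implies m n p t (Together p t x lA) (Together p t x lD)
        (u.eval T x A, s.eval T x A, σ) (v.eval T x A, r.eval T x A, ρ) := by
  cases σ <;> cases ρ <;>
  simp only [implies, Implies, holds_or, holds_and, holds_not, holds_lt, holds_eq,
    holds_coordLT x A h, holds_together x A h, eval_patLen x A h, eval_textLen x A h,
    eval_textAt x A h, eval, and_assoc, or_assoc]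

/-- The index of a literal. -/
def litIndex (n : ℕ) (a : Lit) : ℕ := (a.1 + a.1 + a.2.2.toNat) * (n + 1) + a.2.1

theorem eval_index (h : Describes T m n p t) (u s : Ex b) (σ : Bool) :
    (index u s σ).eval T x A = litIndex n (u.eval T x A, s.eval T x A, σ) := by
  simp [index, eval, eval_thresholds _ A h, litIndex]

theorem litIndex_lt {a : Lit} (ha : a.InRange m n) :
    litIndex n a < (m + m + (m + m)) * (n + 1) := by
  obtain ⟨h1, h2⟩ := ha
  have h3 : a.2.2.toNat ≤ 1 := Bool.toNat_le _
  have h4 : (a.1 + a.1 + a.2.2.toNat + 1) * (n + 1) ≤ (m + m + (m + m)) * (n + 1) :=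
    Nat.mul_le_mul_right _ (by omega)
  rw [add_mul, one_mul] at h4
  unfold litIndex
  omega

theorem litIndex_inj {a c : Lit} (ha : a.InRange m n) (hc : c.InRange m n)
    (h : litIndex n a = litIndex n c) : a = c := by
  obtain ⟨u, s, σ⟩ := a
  obtain ⟨v, r, ρ⟩ := c
  have hs : s < n + 1 := ha.2
  have hr : r < n + 1 := hc.2
  simp only [litIndex] at h
  have h1 : u + u + σ.toNat = v + v + ρ.toNat := by
    have := congrArg (· / (n + 1)) h
    rwa [mul_comm, Nat.mul_add_div (by omega), mul_comm, Nat.mul_add_div (by omega),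
      Nat.div_eq_of_lt hs, Nat.div_eq_of_lt hr] at this
  rw [h1] at h
  have h2 : s = r := by omega
  have h3 : σ.toNat ≤ 1 := Bool.toNat_le _
  have h4 : ρ.toNat ≤ 1 := Bool.toNat_le _
  have h5 : σ.toNat = ρ.toNat := by omega
  have h6 : u = v := by omega
  have h7 : σ = ρ := by cases σ <;> cases ρ <;> simp_all
  rw [h2, h6, h7]

/-- One implication of `I` or its contraposition, between literals in range. -/
def Arrow (m n : ℕ) (I : Lit → Lit → Prop) (a c : Lit) : Prop :=
  a.InRange m n ∧ c.InRange m n ∧ (I a c ∨ I c.neg a.neg)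

/-- The relation between indices of literals that belongs to `Arrow`. -/
def IndexArrow (m n : ℕ) (I : Lit → Lit → Prop) (i j : ℕ) : Prop :=
  ∃ a c, Arrow m n I a c ∧ litIndex n a = i ∧ litIndex n c = j

open Relation in
theorem reflTransGen_indexArrow {I : Lit → Lit → Prop} {a c : Lit} (ha : a.InRange m n)
    (hc : c.InRange m n) : ReflTransGen (IndexArrow m n I) (litIndex n a) (litIndex n c) ↔
      ReflTransGen (Arrow m n I) a c := by
  constructor
  · have key : ∀ j, ReflTransGen (IndexArrow m n I) (litIndex n a) j →
        ∃ d : Lit, d.InRange m n ∧ litIndex n d = j ∧ ReflTransGen (Arrow m n I) a d := by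
      intro j h
      induction h with
      | refl => exact ⟨a, ha, rfl, .refl⟩
      | tail _ h2 ih =>
        obtain ⟨d, hd, rfl, had⟩ := ih
        obtain ⟨e, f, hef, h3, rfl⟩ := h2
        obtain rfl := litIndex_inj hef.1 hd h3
        exact ⟨f, hef.2.1, rfl, had.tail hef⟩
    intro h
    obtain ⟨d, hd, h1, h2⟩ := key _ h
    obtain rfl := litIndex_inj hd hc h1
    exact h2
  · intro h
    exact h.lift (litIndex n) fun d e hde => ⟨d, e, hde, rfl, rfl⟩

theorem holds_reachedBy (h : Describes T m n p t) (lA lD : List (ℕ × ℕ)) (σ ρ : Bool) :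
    (reachedBy lA lD σ ρ).Holds T x A ↔
      Implies m n p t (Together p t x lA) (Together p t x lD) (x 4, x 5, σ) (x 6, x 7, ρ) ∧
        ((A (litIndex n (x 4, x 5, σ)) ≠ 0 ∧ x 3 = litIndex n (x 6, x 7, ρ)) ∨
         (A (litIndex n (x 6, x 7, !ρ)) ≠ 0 ∧ x 3 = litIndex n (x 4, x 5, !σ))) := by
  simp only [reachedBy, holds_and, holds_or, holds_eq, holds_arr, holds_implies x A h,
    eval_index x A h, eval]

/-- Only the variables from `10` on matter for `Together`. -/
theorem Together.congr_vars {x y : ℕ → ℕ} (h : ∀ i, 10 ≤ i → x i = y i) (l : List (ℕ × ℕ)) :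
    Together p t x l = Together p t y l := by
  funext i q
  simp only [Together, BothIn]
  have h0 : ∀ i, x (10 + i) = y (10 + i) := fun i => h _ (by omega)
  have h1 : ∀ i, x (11 + i) = y (11 + i) := fun i => h _ (by omega)
  have h2 : ∀ i, x (12 + i) = y (12 + i) := fun i => h _ (by omega)
  have h3 : ∀ i, x (13 + i) = y (13 + i) := fun i => h _ (by omega)
  simp only [h0, h1, h2, h3]

theorem holds_nextReach (h : Describes T m n p t) (lA lD : List (ℕ × ℕ)) (src : Ex true) :
    (nextReach lA lD src).Holds T x A ↔ x 3 = src.eval T x A ∨ A (x 3) ≠ 0 ∨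
      ∃ i, A i ≠ 0 ∧ IndexArrow m n
        (Implies m n p t (Together p t x lA) (Together p t x lD)) i (x 3) := by
  have hvars : ∀ (u s v r : ℕ) (l : List (ℕ × ℕ)), Together p t (Function.update
      (Function.update (Function.update (Function.update x 4 u) 5 s) 6 v) 7 r) l =
      Together p t x l := fun u s v r l => Together.congr_vars (fun i hi => by
    simp (disch := omega) only [Function.update_of_ne]) l
  simp only [nextReach, holds_or, holds_eq, holds_arr, holds_ex, holds_reachedBy _ A h, hvars,
    eval, eval_patLen _ A h, eval_thresholds _ A h]
  simp only [Function.update_apply, Nat.reduceEqDiff, reduceIte]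
  rw [or_assoc]
  refine or_congr Iff.rfl (or_congr Iff.rfl ?_)
  constructor
  · rintro ⟨u, hu, s, hs, v, hv, r, hr, h1⟩
    obtain ⟨σ, ρ, h1, h2⟩ : ∃ σ ρ, Implies m n p t (Together p t x lA) (Together p t x lD)
        (u, s, σ) (v, r, ρ) ∧ ((A (litIndex n (u, s, σ)) ≠ 0 ∧ x 3 = litIndex n (v, r, ρ)) ∨
         (A (litIndex n (v, r, !ρ)) ≠ 0 ∧ x 3 = litIndex n (u, s, !σ))) := by
      rcases h1 with (h1 | h1) | (h1 | h1)
      exacts [⟨true, true, h1⟩, ⟨true, false, h1⟩, ⟨false, true, h1⟩, ⟨false, false, h1⟩]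
    rcases h2 with ⟨h2, h3⟩ | ⟨h2, h3⟩
    · exact ⟨_, h2, (u, s, σ), (v, r, ρ), ⟨⟨hu, hs⟩, ⟨hv, hr⟩, Or.inl h1⟩, rfl, h3.symm⟩
    · refine ⟨_, h2, (v, r, !ρ), (u, s, !σ), ⟨⟨hv, hr⟩, ⟨hu, hs⟩, Or.inr ?_⟩, rfl, h3.symm⟩
      simpa [Lit.neg] using h1
  · rintro ⟨i, hi, ⟨u, s, σ⟩, ⟨v, r, ρ⟩, ⟨⟨hu, hs⟩, ⟨hv, hr⟩, h1⟩, rfl, h2⟩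
    rcases h1 with h1 | h1
    · refine ⟨u, hu, s, hs, v, hv, r, hr, ?_⟩
      have h3 : Implies m n p t (Together p t x lA) (Together p t x lD) (u, s, σ) (v, r, ρ) ∧
          ((A (litIndex n (u, s, σ)) ≠ 0 ∧ x 3 = litIndex n (v, r, ρ)) ∨
          (A (litIndex n (v, r, !ρ)) ≠ 0 ∧ x 3 = litIndex n (u, s, !σ))) :=
        ⟨h1, Or.inl ⟨hi, h2.symm⟩⟩
      cases σ <;> cases ρ
      exacts [Or.inr (Or.inr h3), Or.inr (Or.inl h3), Or.inl (Or.inr h3), Or.inl (Or.inl h3)]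
    · refine ⟨v, hv, r, hr, u, hu, s, hs, ?_⟩
      have h3 : Implies m n p t (Together p t x lA) (Together p t x lD) (v, r, !ρ) (u, s, !σ) ∧
          ((A (litIndex n (v, r, !ρ)) ≠ 0 ∧ x 3 = litIndex n (u, s, !σ)) ∨
          (A (litIndex n (u, s, !!σ)) ≠ 0 ∧ x 3 = litIndex n (v, r, !!ρ))) :=
        ⟨h1, Or.inr ⟨by rwa [Bool.not_not], by rw [Bool.not_not, h2]⟩⟩
      cases σ <;> cases ρ
      exacts [Or.inl (Or.inl h3), Or.inr (Or.inl h3), Or.inl (Or.inr h3), Or.inr (Or.inr h3)]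

open Relation in
theorem holds_flips (h : Describes T m n p t) (lA lD : List (ℕ × ℕ)) (σ : Bool)
    (h1 : x 1 < m + m) (h2 : x 2 < n + 1) :
    (flips lA lD σ).Holds T x A ↔ ReflTransGen (Arrow m n
      (Implies m n p t (Together p t x lA) (Together p t x lD))) (x 1, x 2, σ) (x 1, x 2, !σ) := by
  have ha : Lit.InRange m n (x 1, x 2, σ) := ⟨h1, h2⟩
  have hc : Lit.InRange m n (x 1, x 2, !σ) := ⟨h1, h2⟩
  rw [flips, Holds, eval_fix]
  have hL : (litCount : Ex true).eval T x A = (m + m + (m + m)) * (n + 1) := by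
    simp [litCount, eval, eval_thresholds _ A h, eval_patLen _ A h]
  rw [hL, ← Holds, holds_arr, eval_index _ _ h]
  have hvars : ∀ (j : ℕ) (l : List (ℕ × ℕ)), Together p t (Function.update x 3 j) l =
      Together p t x l := fun j l => Together.congr_vars (fun i hi => by
    simp (disch := omega) only [Function.update_of_ne]) l
  refine (iterate_closure (litIndex_lt ha) (R := IndexArrow m n
    (Implies m n p t (Together p t x lA) (Together p t x lD))) ?_ (round_le_one _ _ _ _ _)
    ?_ _).trans (reflTransGen_indexArrow ha hc)
  · rintro i j ⟨a, c, hac, rfl, rfl⟩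
    exact litIndex_lt hac.2.1
  · intro B j
    have h3 := holds_nextReach (Function.update x 3 j) B h lA lD (index (var 1) (var 2) σ)
    simp only [hvars, eval_index _ _ h, eval] at h3
    simp only [Function.update_apply, Nat.reduceEqDiff, reduceIte] at h3
    rw [← h3, round, Holds]
    split_ifs with h4
    · simp only [h4, true_and]
      omega
    · simp [h4]

/-- What the decision procedure computes. -/
theorem holds_decision (h : Describes T m n p t) (lA lD : List (ℕ × ℕ)) (k : ℕ) :
    (decision lA lD k).Holds T x A ↔ ∃ y : ℕ → ℕ, (∀ i < k, y (10 + i) < m + n + 1) ∧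
      (∀ i, (∀ j < k, i ≠ 10 + j) → y i = x i) ∧
      ∃ S, Solves m n (Implies m n p t (Together p t y lA) (Together p t y lD)) S := by
  rw [decision, holds_not, holds_not, not_not, holds_exMany (n := m + n + 1) T x A
    (fun y => by simp only [eval, eval_patLen y A h, eval_textLen y A h])]
  refine exists_congr fun y => and_congr Iff.rfl (and_congr Iff.rfl ?_)
  rw [exists_solves_iff]
  simp only [holds_all, eval, eval_patLen _ A h, eval_thresholds _ A h]
  refine forall₂_congr fun u hu => forall₂_congr fun s hs => ?_
  have hvars : ∀ (l : List (ℕ × ℕ)), Together p t (Function.update (Function.update y 1 u) 2 s) l =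
      Together p t y l := fun l => Together.congr_vars (fun i hi => by
    simp (disch := omega) only [Function.update_of_ne]) l
  rw [holds_not, holds_and, holds_flips _ A h lA lD true (by simpa using hu) (by simpa using hs),
    holds_flips _ A h lA lD false (by simpa using hu) (by simpa using hs), hvars, hvars]
  simp only [Function.update_apply, Nat.reduceEqDiff, reduceIte]
  rfl

end Ex

/-! ### Griddings and embeddings -/

/-- `p` lists the values of `π`, counted from `1`. -/
def FinPerm.ListedBy (π : FinPerm) (p : ℕ → ℕ) : Prop :=
  ∀ i : Fin π.len, p i = (π.perm i : ℕ) + 1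

namespace FinPerm.ListedBy

variable {π : FinPerm} {p : ℕ → ℕ}

theorem bounds (h : π.ListedBy p) (i : ℕ) (hi : i < π.len) : 1 ≤ p i ∧ p i ≤ π.len := by
  have h1 := h ⟨i, hi⟩
  have h2 := (π.perm ⟨i, hi⟩).2
  simp only at h1
  omega

theorem inj (h : π.ListedBy p) {i j : ℕ} (hi : i < π.len) (hj : j < π.len) (hij : p i = p j) :
    i = j := by
  have h1 := h ⟨i, hi⟩
  have h2 := h ⟨j, hj⟩
  simp only at h1 h2
  have h3 : π.perm ⟨i, hi⟩ = π.perm ⟨j, hj⟩ := Fin.ext (by omega)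
  simpa using π.perm.injective h3

theorem surj (h : π.ListedBy p) {v : ℕ} (hv : v < π.len) : ∃ i < π.len, p i = v + 1 :=
  ⟨π.perm.symm ⟨v, hv⟩, (π.perm.symm ⟨v, hv⟩).2, by simp [h (π.perm.symm ⟨v, hv⟩)]⟩

theorem contains_iff {τ : FinPerm} {t : ℕ → ℕ} (hp : π.ListedBy p) (ht : τ.ListedBy t) :
    τ.Contains π ↔ ∃ f, Embeds π.len τ.len p t f := by
  constructor
  · rintro ⟨f, hf⟩
    refine ⟨fun i => if h : i < π.len then f ⟨i, h⟩ else 0, fun i hi => ?_, fun i j hij hj => ?_,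
      fun i hi j hj hij => ?_⟩
    · simp only [dif_pos hi]
      exact (f ⟨i, hi⟩).2
    · simp only [dif_pos hj, dif_pos (hij.trans hj)]
      exact (hf ⟨i, hij.trans hj⟩ ⟨j, hj⟩).1.2 hij
    · simp only [dif_pos hi, dif_pos hj]
      rw [ht, ht, Nat.add_lt_add_iff_right]
      refine (hf ⟨i, hi⟩ ⟨j, hj⟩).2.2 ?_
      have h1 := hp ⟨i, hi⟩
      have h2 := hp ⟨j, hj⟩
      simp only at h1 h2
      rw [Fin.lt_def]
      omega
  · rintro ⟨f, hfn, hfm, hft⟩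
    have hF : StrictMono fun i : Fin π.len => (⟨f i, hfn i i.2⟩ : Fin τ.len) :=
      fun i j hij => hfm i j hij j.2
    have hV : ∀ a b : Fin π.len, π.perm a < π.perm b →
        τ.perm ⟨f a, hfn a a.2⟩ < τ.perm ⟨f b, hfn b b.2⟩ := by
      intro a b hab
      have h1 := hft a a.2 b b.2 (by rw [hp, hp]; exact Nat.succ_lt_succ hab)
      have h2 := ht ⟨f a, hfn a a.2⟩
      have h3 := ht ⟨f b, hfn b b.2⟩
      simp only at h2 h3
      rw [Fin.lt_def]
      omega
    refine ⟨fun i => ⟨f i, hfn i i.2⟩, fun a b => ⟨hF.lt_iff_lt, fun h => ?_, hV a b⟩⟩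
    rcases lt_trichotomy (π.perm a) (π.perm b) with h1 | h1 | h1
    · exact h1
    · obtain rfl := π.perm.injective h1
      exact absurd h (lt_irrefl _)
    · exact absurd h (hV b a h1).not_gt

end FinPerm.ListedBy

theorem exists_threshold (m : ℕ) (P : ℕ → Prop) (hP : ∀ i j, i ≤ j → j < m → P j → P i) :
    ∃ a ≤ m, ∀ i < m, i < a ↔ P i := by
  induction m with
  | zero => exact ⟨0, le_rfl, by omega⟩
  | succ m ih =>
    by_cases h : P m
    · exact ⟨m + 1, le_rfl, fun i hi => iff_of_true hi (hP i m (by omega) (by omega) h)⟩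
    · obtain ⟨a, ha, h1⟩ := ih fun i j hij hj => hP i j hij (by omega)
      refine ⟨a, by omega, fun i hi => ?_⟩
      rcases Nat.lt_succ_iff_lt_or_eq.1 hi with h2 | rfl
      · exact h1 i h2
      · exact iff_of_false (by omega) h

theorem exists_mem_interval {k : ℕ} {c : Fin (k + 1) → ℕ} (h0 : c 0 = 0) {x : ℕ}
    (hx : x < c (Fin.last k)) : ∃ i : Fin k, c i.castSucc ≤ x ∧ x < c i.succ := by
  by_contra! h
  have h1 : ∀ i, c i ≤ x := by
    intro i
    induction i using Fin.induction with
    | zero => omega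
    | succ i ih => exact h i ih
  have := h1 (Fin.last k)
  omega

namespace Gridding

variable {k l : ℕ} {τ : FinPerm} {g : Gridding k l τ} {M : GriddingMatrix k l}

theorem exists_mem_cell (g : Gridding k l τ) (q : Fin τ.len) : ∃ i j, q ∈ g.cell i j := by
  obtain ⟨i, hi⟩ := exists_mem_interval g.c_first (x := q) (by rw [g.c_last]; exact q.2)
  obtain ⟨j, hj⟩ := exists_mem_interval g.r_first (x := τ.perm q)
    (by rw [g.r_last]; exact (τ.perm q).2)
  exact ⟨i, j, hi, hj⟩

theorem IsGriddingFor.increasing (hg : g.IsGriddingFor M) {i : Fin k} {j : Fin l}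
    (hM : M i j = PermClass.av FinPerm.p21) {a b : Fin τ.len} (ha : a ∈ g.cell i j)
    (hb : b ∈ g.cell i j) (hab : a ≤ b) : τ.perm a ≤ τ.perm b := by
  obtain ⟨σ, hσ, h, hh, hr⟩ := hg i j ⟨a, ha⟩
  rw [← hr] at ha hb
  obtain ⟨a, rfl⟩ := ha
  obtain ⟨b, rfl⟩ := hb
  by_contra! hlt
  have h1 : h a < h b := lt_of_le_of_ne hab (by rintro h2; rw [h2] at hlt; exact lt_irrefl _ hlt)
  rw [(hh a b).1] at h1
  rw [(hh b a).2] at hlt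
  rw [hM] at hσ
  have hP : ∀ x y : Fin 2, FinPerm.p21.perm x < FinPerm.p21.perm y ↔ y < x := by decide
  refine hσ ⟨(![a, b] : Fin 2 → Fin σ.len), fun x y => ⟨?_, Iff.trans ?_ (hP x y).symm⟩⟩ <;>
    change Fin 2 at x y <;> fin_cases x <;> fin_cases y <;> simp [h1, hlt, h1.le, hlt.le]

theorem IsGriddingFor.decreasing (hg : g.IsGriddingFor M) {i : Fin k} {j : Fin l}
    (hM : M i j = PermClass.av FinPerm.p12) {a b : Fin τ.len} (ha : a ∈ g.cell i j)
    (hb : b ∈ g.cell i j) (hab : a ≤ b) : τ.perm b ≤ τ.perm a := by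
  obtain ⟨σ, hσ, h, hh, hr⟩ := hg i j ⟨a, ha⟩
  rw [← hr] at ha hb
  obtain ⟨a, rfl⟩ := ha
  obtain ⟨b, rfl⟩ := hb
  by_contra! hlt
  have h1 : h a < h b := lt_of_le_of_ne hab (by rintro h2; rw [h2] at hlt; exact lt_irrefl _ hlt)
  rw [(hh a b).1] at h1
  rw [(hh a b).2] at hlt
  rw [hM] at hσ
  have hP : ∀ x y : Fin 2, FinPerm.p12.perm x < FinPerm.p12.perm y ↔ x < y := by decide
  refine hσ ⟨(![a, b] : Fin 2 → Fin σ.len), fun x y => ⟨?_, Iff.trans ?_ (hP x y).symm⟩⟩ <;>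
    change Fin 2 at x y <;> fin_cases x <;> fin_cases y <;> simp [h1, hlt, h1.le, hlt.le]

end Gridding

open Classical in
/-- The cells of a gridding matrix with a given entry, as pairs of column and row. -/
noncomputable def GriddingMatrix.cells {k l : ℕ} (M : GriddingMatrix k l) (E : PermClass) :
    List (ℕ × ℕ) :=
  ((Finset.univ.filter fun c : Fin k × Fin l => M c.1 c.2 = E).toList).map
    fun c => (c.1.val, c.2.val)

theorem GriddingMatrix.mem_cells {k l : ℕ} {M : GriddingMatrix k l} {E : PermClass} {c : ℕ × ℕ} :
    c ∈ M.cells E ↔ ∃ (i : Fin k) (j : Fin l), M i j = E ∧ c = (i.val, j.val) := by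
  simp [GriddingMatrix.cells, eq_comm]

open Ex in
/-- The cut points of a gridding of the text, and their pullbacks along an embedding, are values of
the variables for which the system of implications can be solved. -/
theorem exists_cuts {k l : ℕ} {M : GriddingMatrix k l} (hM : M.IsMonotone) {π τ : FinPerm}
    {p t : ℕ → ℕ} (hp : π.ListedBy p) (ht : τ.ListedBy t) (g : Gridding k l τ)
    (hg : g.IsGriddingFor M) (x : ℕ → ℕ) {f : ℕ → ℕ} (hf : Embeds π.len τ.len p t f) :
    ∃ y : ℕ → ℕ, (∀ i < 4 * (k + l + 1), y (10 + i) < π.len + τ.len + 1) ∧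
      (∀ i, (∀ j < 4 * (k + l + 1), i ≠ 10 + j) → y i = x i) ∧
      ∃ S, Solves π.len τ.len (Implies π.len τ.len p t
        (Together p t y (M.cells (PermClass.av FinPerm.p21)))
        (Together p t y (M.cells (PermClass.av FinPerm.p12)))) S := by
  have hfe := hf
  obtain ⟨hfn, hfm, hft⟩ := hf
  -- Pullbacks of cuts between columns and of cuts between rows.
  have hC : ∀ s, ∃ a ≤ π.len, ∀ i < π.len, i < a ↔ f i < s := fun s =>
    exists_threshold π.len (fun i => f i < s) fun i j hij hj h => by
      rcases hij.eq_or_lt with rfl | hij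
      · exact h
      · exact (hfm i j hij hj).trans h
  have hR : ∀ s, ∃ a ≤ π.len, ∀ i < π.len, p i ≤ a ↔ t (f i) ≤ s := fun s => by
    obtain ⟨a, ha, h1⟩ := exists_threshold π.len
      (fun v => ∃ i < π.len, p i = v + 1 ∧ t (f i) ≤ s) (by
        rintro v w hvw hw ⟨i, hi, h1, h2⟩
        obtain ⟨j, hj, h3⟩ := hp.surj (hvw.trans_lt hw)
        refine ⟨j, hj, h3, ?_⟩
        rcases hvw.eq_or_lt with rfl | hvw
        · rw [hp.inj hj hi (h3.trans h1.symm)]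
          exact h2
        · exact (hft j hj i hi (by omega)).le.trans h2)
    refine ⟨a, ha, fun i hi => ?_⟩
    have h2 := hp.bounds i hi
    have h3 := h1 (p i - 1) (by omega)
    have h4 : p i - 1 + 1 = p i := by omega
    rw [h4] at h3
    constructor
    · intro h5
      obtain ⟨j, hj, h6, h7⟩ := h3.1 (by omega)
      rwa [hp.inj hj hi h6] at h7
    · intro h5
      have := h3.2 ⟨i, hi, rfl, h5⟩
      omega
  choose cp hcp hcp' using hC
  choose rp hrp hrp' using hR
  set c : ℕ → ℕ := fun i => if h : i < k + 1 then g.c ⟨i, h⟩ else 0 with hc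
  set r : ℕ → ℕ := fun i => if h : i < l + 1 then g.r ⟨i, h⟩ else 0 with hr
  have hcn : ∀ i, c i ≤ τ.len := by
    intro i
    simp only [hc]
    split_ifs with h
    · rw [← g.c_last]
      exact g.c_mono (Fin.le_last _)
    · exact Nat.zero_le _
  have hrn : ∀ i, r i ≤ τ.len := by
    intro i
    simp only [hr]
    split_ifs with h
    · rw [← g.r_last]
      exact g.r_mono (Fin.le_last _)
    · exact Nat.zero_le _
  set y : ℕ → ℕ := fun v => if v < 10 ∨ 10 + 4 * (k + l + 1) ≤ v then x v else
    if (v - 10) % 4 = 0 then c ((v - 10) / 4) else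
    if (v - 10) % 4 = 1 then cp (c ((v - 10) / 4)) else
    if (v - 10) % 4 = 2 then r ((v - 10) / 4) else rp (r ((v - 10) / 4)) with hy
  have hy0 : ∀ i ≤ k + l, y (10 + 4 * i) = c i := fun i hi => by
    simp only [hy]
    rw [if_neg (by omega), if_pos (by omega)]
    congr 1
    omega
  have hy1 : ∀ i ≤ k + l, y (11 + 4 * i) = cp (c i) := fun i hi => by
    simp only [hy]
    rw [if_neg (by omega), if_neg (by omega), if_pos (by omega)]
    congr 2
    omega
  have hy2 : ∀ i ≤ k + l, y (12 + 4 * i) = r i := fun i hi => by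
    simp only [hy]
    rw [if_neg (by omega), if_neg (by omega), if_neg (by omega), if_pos (by omega)]
    congr 1
    omega
  have hy3 : ∀ i ≤ k + l, y (13 + 4 * i) = rp (r i) := fun i hi => by
    simp only [hy]
    rw [if_neg (by omega), if_neg (by omega), if_neg (by omega), if_neg (by omega)]
    congr 2
    omega
  have hcell : ∀ (i : Fin k) (j : Fin l) (q : Fin τ.len), q ∈ g.cell i j ↔
      (c i ≤ q ∧ q < c (i + 1)) ∧ (r j < t q ∧ t q ≤ r (j + 1)) := by
    intro i j q
    have h1 : c i = g.c i.castSucc := dif_pos (by omega)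
    have h2 : c (i + 1) = g.c i.succ := dif_pos (by omega)
    have h3 : r j = g.r j.castSucc := dif_pos (by omega)
    have h4 : r (j + 1) = g.r j.succ := dif_pos (by omega)
    rw [h1, h2, h3, h4, ht q, Nat.lt_add_one_iff, Nat.add_one_le_iff]
    exact Iff.rfl
  have hboth : ∀ (i : Fin k) (j : Fin l) (a : ℕ) (ha : a < π.len) (q : Fin τ.len),
      BothIn p t y a q (i.val, j.val) ↔ q ∈ g.cell i j ∧ ⟨f a, hfn a ha⟩ ∈ g.cell i j := by
    intro i j a ha q
    have hi := i.2
    have hj := j.2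
    have h1 : cp (c i) ≤ a ↔ c i ≤ f a := by
      have := hcp' (c i) a ha
      omega
    have h2 : rp (r j) < p a ↔ r j < t (f a) := by
      have := hrp' (r j) a ha
      omega
    simp only [BothIn]
    rw [hy0 _ (by omega), hy0 _ (by omega), hy1 _ (by omega), hy1 _ (by omega),
      hy2 _ (by omega), hy2 _ (by omega), hy3 _ (by omega), hy3 _ (by omega), hcell, hcell,
      hcp' _ a ha, hrp' _ a ha, h1, h2]
    simp only
    tauto
  refine ⟨y, fun i hi => ?_, fun i hi => ?_, ?_⟩
  · have h1 := hcn (i / 4)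
    have h2 := hrn (i / 4)
    have h3 := hcp (c (i / 4))
    have h4 := hrp (r (i / 4))
    simp only [hy, Nat.add_sub_cancel_left]
    split_ifs <;> omega
  · simp only [hy]
    refine if_pos ?_
    by_contra! h
    exact hi (i - 10) (by omega) (by omega)
  · have hmono : ∀ a b : Fin τ.len, τ.perm a ≤ τ.perm b → t a ≤ t b := fun a b hab => by
      rw [ht, ht]
      exact Nat.succ_le_succ hab
    refine hfe.exists_solves ht.bounds (fun a ha => ?_) (fun a ha q hq h => ?_)
      (fun a ha q hq h => ?_)
    · obtain ⟨i, j, hij⟩ := g.exists_mem_cell ⟨f a, hfn a ha⟩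
      have h1 := (hboth i j a ha ⟨f a, hfn a ha⟩).2 ⟨hij, hij⟩
      rcases hM i j with h2 | h2 | h2
      · exact Or.inl ⟨_, GriddingMatrix.mem_cells.2 ⟨i, j, h2, rfl⟩, h1⟩
      · exact Or.inr ⟨_, GriddingMatrix.mem_cells.2 ⟨i, j, h2, rfl⟩, h1⟩
      · obtain ⟨σ, hσ, -⟩ := hg i j ⟨_, hij⟩
        rw [h2] at hσ
        exact hσ.elim
    · obtain ⟨_, hc', h1⟩ := h
      obtain ⟨i, j, h2, rfl⟩ := GriddingMatrix.mem_cells.1 hc'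
      obtain ⟨h3, h4⟩ := (hboth i j a ha ⟨q, hq⟩).1 h1
      exact ⟨fun h5 => hmono ⟨q, hq⟩ ⟨f a, hfn a ha⟩ (hg.increasing h2 h3 h4 h5),
        fun h5 => hmono ⟨f a, hfn a ha⟩ ⟨q, hq⟩ (hg.increasing h2 h4 h3 h5)⟩
    · obtain ⟨_, hc', h1⟩ := h
      obtain ⟨i, j, h2, rfl⟩ := GriddingMatrix.mem_cells.1 hc'
      obtain ⟨h3, h4⟩ := (hboth i j a ha ⟨q, hq⟩).1 h1
      exact ⟨fun h5 => hmono ⟨f a, hfn a ha⟩ ⟨q, hq⟩ (hg.decreasing h2 h3 h4 h5),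
        fun h5 => hmono ⟨q, hq⟩ ⟨f a, hfn a ha⟩ (hg.decreasing h2 h4 h3 h5)⟩

open Ex in
/-- The decision procedure is correct for texts that are griddable by `M`. -/
theorem holds_decision_iff_contains {k l : ℕ} {M : GriddingMatrix k l} (hM : M.IsMonotone)
    {π τ : FinPerm} (hτ : τ ∈ gridClass M) {T p t : ℕ → ℕ} (hp : π.ListedBy p)
    (ht : τ.ListedBy t) (hT : Describes T π.len τ.len p t) (x A : ℕ → ℕ) :
    (decision (M.cells (PermClass.av FinPerm.p21)) (M.cells (PermClass.av FinPerm.p12))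
      (4 * (k + l + 1))).Holds T x A ↔ τ.Contains π := by
  rw [holds_decision x A hT, hp.contains_iff ht]
  constructor
  · rintro ⟨y, -, -, S, hS⟩
    exact hS.exists_embeds ht.bounds
  · rintro ⟨f, hf⟩
    obtain ⟨g, hg⟩ := hτ
    exact exists_cuts hM hp ht g hg x hf

/-! ### Reading the input -/

namespace Ex

/-- Read a number into register `v` and append it to the input table; register `12` points behind
the end of the table. -/
def readOne (v : ℕ) : Cmd := .ops [.read v, .store 12 v, .const 44 4, .add 12 12 44]

/-- Read the code of a permutation and append it to the input table. -/
def readPerm : Cmd := (readOne 20).seq (.countdown 20 36 (readOne 28))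

/-- The input table has been filled with the list `w`; all registers other than those of the table
and the auxiliary ones are `0`. -/
structure Loaded (w : List ℕ) (x : ℕ → ℕ) : Prop where
  ptr : x 12 = 4 * w.length + 1
  table : ∀ a, x (4 * a + 1) = w.getD a 0
  rest : ∀ r, r % 4 ≠ 1 → r % 8 ≠ 4 → x r = 0

theorem Loaded.congr {w : List ℕ} {x y : ℕ → ℕ} (h : Loaded w x)
    (hy : ∀ r, (r % 8 ≠ 4 ∨ r = 12) → y r = x r) : Loaded w y :=
  ⟨by rw [hy _ (by omega), h.ptr], fun a => by rw [hy _ (by omega), h.table],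
    fun r h1 h2 => by rw [hy _ (by omega), h.rest r h1 h2]⟩

theorem readOne_runs {v : ℕ} (hv : v % 8 = 4) (h12 : v ≠ 12) (h44 : v ≠ 44) {w : List ℕ}
    {x : ℕ → ℕ} (hx : Loaded w x) (c : ℕ) (inp : List ℕ) :
    ∃ y, Loaded (w ++ [c]) y ∧ y v = c ∧ (∀ r, r % 8 = 4 → r ≠ v → r ≠ 12 → r ≠ 44 → y r = x r) ∧
      (readOne v).Runs (x, c :: inp) 4 (y, inp) := by
  set y : ℕ → ℕ := Function.update (Function.update (Function.update (Function.update x v c)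
    (4 * w.length + 1) c) 44 4) 12 (4 * w.length + 1 + 4) with hy
  refine ⟨y, ⟨?_, fun a => ?_, fun r h1 h2 => ?_⟩, ?_, fun r h1 h2 h3 h4 => ?_, ?_⟩
  · rw [hy, Function.update_self, List.length_append, List.length_singleton]
    omega
  · rcases eq_or_ne a w.length with rfl | hne
    · simp (disch := omega) only [hy, Function.update_of_ne, Function.update_self]
      simp
    · simp (disch := omega) only [hy, Function.update_of_ne]
      rw [hx.table]
      rcases hne.lt_or_gt with h | h
      · rw [List.getD_append _ _ _ _ h]
      · rw [List.getD_eq_default _ _ h.le, List.getD_eq_default _ _ (by simp; omega)]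
  · simp (disch := omega) only [hy, Function.update_of_ne]
    exact hx.rest r h1 h2
  · simp (disch := omega) only [hy, Function.update_of_ne, Function.update_self]
  · simp (disch := omega) only [hy, Function.update_of_ne]
  · have h := Cmd.runs_ops (l := [.read v, .store 12 v, .const 44 4, .add 12 12 44]) rfl
      (x, c :: inp)
    have h1 : [RAMInstr.read v, .store 12 v, .const 44 4, .add 12 12 44].foldl RAMInstr.act
        (x, c :: inp) = (y, inp) := by
      simp only [List.foldl, RAMInstr.act, RAMInstr.exec, List.headD_cons, List.tail_cons]
      simp (disch := omega) only [Function.update_of_ne, Function.update_self, hx.ptr]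
      rfl
    rwa [h1] at h

theorem readPerm_runs {w : List ℕ} {x : ℕ → ℕ} (hx : Loaded w x) (a rest : List ℕ) :
    ∃ y, Loaded (w ++ a.length :: a) y ∧
      readPerm.Runs (x, a.length :: a ++ rest) (4 + (a.length * 8 + 1)) (y, rest) := by
  obtain ⟨y, hy, hyv, -, hyr⟩ := readOne_runs (v := 20) rfl (by omega) (by omega) hx a.length
    (a ++ rest)
  obtain ⟨⟨z, inp⟩, ⟨-, w', a', h1, h2, h3, h4⟩, hzr⟩ :=
    Cmd.runs_countdown (r := 20) (u := 36) (by omega) (c := readOne 28) (t := 4)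
    (fun j z => z.1 20 = j ∧ ∃ w' a', Loaded w' z.1 ∧ z.2 = a' ++ rest ∧ a'.length = j ∧
      w' ++ a' = w ++ a.length :: a) (fun j z hz => hz.1)
    (fun j z hz => by
      obtain ⟨hz0, w', a', h1, h2, h3, h4⟩ := hz
      obtain ⟨c, a', rfl⟩ := List.exists_cons_of_length_eq_add_one h3
      have h5 : Loaded w' (Function.update (Function.update z.1 36 1) 20 j) := h1.congr
        fun r hr => by
          rw [Function.update_of_ne (by omega), Function.update_of_ne (by omega)]
      obtain ⟨v, hv, -, hv2, hvr⟩ := readOne_runs (v := 28) rfl (by omega) (by omega) h5 c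
        (a' ++ rest)
      refine ⟨(v, a' ++ rest), ⟨?_, w' ++ [c], a', hv, rfl, by simpa using h3, by simpa using h4⟩,
        ?_⟩
      · simp only
        rw [hv2 20 (by omega) (by omega) (by omega) (by omega), Function.update_self]
      · rw [h2]
        exact hvr)
    a.length (y, a ++ rest) ⟨hyv, w ++ [a.length], a, hy, rfl, rfl, by simp⟩
  simp only at h1 h2
  obtain rfl := List.length_eq_zero_iff.1 h3
  rw [List.append_nil] at h4
  rw [List.nil_append] at h2
  subst h2
  rw [h4] at h1
  exact ⟨z, h1, hyr.seq hzr⟩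

/-- The whole program: read the input, evaluate the expression, and put its value into
register `0`. -/
def program (e : Ex false) : Cmd :=
  ((((Cmd.ops [.const 12 1]).seq readPerm).seq readPerm).seq (e.comp 0)).seq (.ops (move 0 4))

theorem program_runs (e : Ex false) {N : ℕ} (a a' : List ℕ)
    (hN : ∀ c ∈ (a.length :: a) ++ (a'.length :: a'), c ≤ N) :
    ∃ y : ℕ → ℕ, y 0 = e.eval (fun i => ((a.length :: a) ++ (a'.length :: a')).getD i 0) 0 0 ∧
      (program e).Runs ((fun _ => 0), (a.length :: a) ++ (a'.length :: a'))
        (1 + (4 + (a.length * 8 + 1)) + (4 + (a'.length * 8 + 1)) +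
          (e.tm fun _ => 0).eval N + 2) (y, []) := by
  set w := (a.length :: a) ++ (a'.length :: a') with hw
  have h0 : Loaded [] (Function.update (fun _ => 0) 12 1) := by
    refine ⟨by simp, fun i => ?_, fun r h1 h2 => ?_⟩
    · rw [Function.update_of_ne (by omega)]
      simp
    · rw [Function.update_of_ne (by omega)]
  obtain ⟨x, hx, hxr⟩ := readPerm_runs h0 a (a'.length :: a')
  obtain ⟨y, hy, hyr⟩ := readPerm_runs hx a' []
  rw [List.nil_append, ← hw] at hy
  rw [List.append_nil] at hyr
  have e1 : tabOf y = fun i => w.getD i 0 := funext hy.table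
  have e2 : varsOf y = 0 := funext fun i => hy.rest _ (by omega) (by omega)
  have e3 : arrOf y = 0 := funext fun i => hy.rest _ (by omega) (by omega)
  obtain ⟨z, -, hzv, hzr⟩ := compSpec e 0 N (fun _ => 0) y [] (fun _ => e3)
    (by simp [e3])
    (by
      intro i
      rw [e1]
      simp only [List.getD_eq_getElem?_getD]
      cases h : w[i]? with
      | none => simp
      | some c => simpa using hN c (List.mem_of_getElem? h))
    (by simp [e2])
  refine ⟨after (move 0 4) z, ?_, ?_⟩
  · rw [after_move (by omega), Function.update_self]
    rw [e1, e2, e3] at hzv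
    exact hzv
  · exact ((((Cmd.runs_ops (l := [.const 12 1]) rfl _).seq hxr).seq hyr).seq hzr).seq
      (runs_after rfl z [])

end Ex

namespace FinPerm

theorem code_eq (π : FinPerm) : π.code = (List.ofFn fun i => (π.perm i : ℕ) + 1).length ::
    List.ofFn fun i => (π.perm i : ℕ) + 1 := by
  rw [List.length_ofFn]
  rfl

theorem length_code (π : FinPerm) : π.code.length = π.len + 1 := by
  simp [code]

theorem le_of_mem_code {π : FinPerm} {c : ℕ} (hc : c ∈ π.code) : c ≤ π.len := by
  rcases List.mem_cons.1 hc with rfl | hc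
  · exact le_rfl
  · obtain ⟨i, rfl⟩ := (List.mem_ofFn' _ _).1 hc
    exact (π.perm i).2

theorem getD_code_succ (π : FinPerm) (i : Fin π.len) :
    π.code.getD (i + 1) 0 = (π.perm i : ℕ) + 1 := by
  rw [code, List.getD_cons_succ, List.getD_eq_getElem _ _ (by simp), List.getElem_ofFn]

end FinPerm

theorem mainTheorem2 (C : PermClass) (hC : C.MonotoneGriddable) :
    C.PPMSolvableInPolyTime := by
  classical
  obtain ⟨k, l, M, hM, hCM⟩ := hC
  set e := Ex.decision (M.cells (PermClass.av FinPerm.p21)) (M.cells (PermClass.av FinPerm.p12))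
    (4 * (k + l + 1)) with he
  refine ⟨(Ex.program e).code 0, 8 * Polynomial.X + 13 + e.tm fun _ => 0, fun π _ τ hτ => ?_⟩
  set T : ℕ → ℕ := fun i => (π.code ++ τ.code).getD i 0 with hT
  have hT1 : ∀ i < π.len + 1, T i = π.code.getD i 0 := fun i hi =>
    List.getD_append _ _ _ _ (by rwa [FinPerm.length_code])
  have hT2 : ∀ i, T (1 + π.len + i) = τ.code.getD i 0 := fun i => by
    rw [hT]
    dsimp only
    rw [List.getD_append_right _ _ _ _ (by rw [FinPerm.length_code]; omega), FinPerm.length_code]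
    congr 1
    omega
  have hD : Ex.Describes T π.len τ.len (fun i => T (1 + i)) fun i => T (2 + π.len + i) :=
    ⟨hT1 0 (by omega), fun _ => rfl, hT2 0, fun _ => rfl⟩
  have hp : π.ListedBy fun i => T (1 + i) := fun i => by
    dsimp only
    rw [hT1 _ (by omega), add_comm]
    exact π.getD_code_succ i
  have ht : τ.ListedBy fun i => T (2 + π.len + i) := fun i => by
    dsimp only
    rw [← τ.getD_code_succ i, ← hT2]
    congr 1
    omega
  have hval : e.eval T 0 0 = if τ.Contains π then 1 else 0 := by
    have h1 := holds_decision_iff_contains hM (hCM hτ) hp ht hD 0 0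
    rw [← he] at h1
    have h2 : e.eval T 0 0 ≤ 1 := by
      rw [he, Ex.decision, Ex.not, Ex.eval]
      exact Nat.sub_le _ _
    split_ifs with h
    · have := h1.2 h
      rw [Ex.Holds] at this
      omega
    · by_contra h3
      exact h (h1.1 h3)
  obtain ⟨y, hy, hr⟩ := Ex.program_runs e (N := π.len + τ.len)
    (List.ofFn fun i => (π.perm i : ℕ) + 1) (List.ofFn fun i => (τ.perm i : ℕ) + 1) (by
      rw [← FinPerm.code_eq, ← FinPerm.code_eq]
      intro c hc
      rcases List.mem_append.1 hc with hc | hc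
      · have := FinPerm.le_of_mem_code hc
        omega
      · have := FinPerm.le_of_mem_code hc
        omega)
  rw [← FinPerm.code_eq, ← FinPerm.code_eq] at hy hr
  obtain ⟨u, hu, hstep⟩ := hr ((Ex.program e).code 0) 0 ⟨[], [], by simp, rfl⟩
  rw [List.length_ofFn, List.length_ofFn] at hu
  refine ⟨u, hu.trans ?_, ?_, ?_⟩
  · simp only [Polynomial.eval_add, Polynomial.eval_mul, Polynomial.eval_X, Polynomial.eval_ofNat]
    omega
  · rw [RAMProgram.init, hstep, RAMProgram.Halted, Cmd.length_code]
    simp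
  · rw [RAMProgram.init, hstep]
    simp only
    rw [hy]
    exact hval
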